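/- **Theorem 4.5 (Evolution variational inequality).** Let $(X,d)$ be a complete metric space, $\lambda\in\mathbb R$, and let $\phi:X\to(-\infty,\infty]$ be lower semicontinuous with $D(\phi):=\{\phi<\infty\}\neq\emptyset$. A *minimal geodesic* from $x$ to $y$ is a curve $\gamma:[0,1]\to X$ with $\gamma(0)=x$, $\gamma(1)=y$ and $d(\gamma(s),\gamma(t))=|s-t|\,d(x,y)$ for all $s,t\in[0,1]$. For $\kappa\in\mathbb R$, a function $f:X\to(-\infty,\infty]$ is *$\kappa$-convex along $\gamma$* if, for all $t\in[0,1]$, $$f(\gamma(t))\le(1-t)f(\gamma(0))+tf(\gamma(1))-\tfrac{\kappa}{2}(1-t)t\,d^2(\gamma(0),\gamma(1)).$$ For $\tau>0$ and $x\in X$ put $\phi_\tau(x)=\inf_{z\in X}\{\phi(z)+d^2(x,z)/(2\tau)\}$, and let $J_\tau^\phi(x)$ be the set of points $z$ attaining this infimum. Assume one of the following. * **Case I.** $X$ is a CAT(1)-space (a geodesic space in which every geodesic triangle of perimeter less than $2\pi$ is at most as thick as its comparison triangle in the unit sphere $\mathbb S^2$) with $\operatorname{diam}X<\pi/2$, and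 any two points of $D(\phi)$ are joined by some minimal geodesic along which $\phi$ is $\lambda$-convex. * **Case II.** $\phi$ is coercive: there is $\tau_*>0$ such that $\phi_\tau(x)>-\infty$ and $J^\phi_\tau(x)\ne\emptyset$ for all $x\in X$ and $\tau\in(0,\tau_*)$. Moreover, there are $K\in\mathbb R$ and a family $\Gamma$ of minimal geodesics with endpoints in $D(\phi)$, joining any two points of $D(\phi)$, such that $\phi$ is $\lambda$-convex and, for every $z\in D(\phi)$, $d^2(z,\cdot)$ is $K$-convex along every $\gamma\in\Gamma$, and such that for all $\gamma,\eta\in\Gamma$ with $\gamma(0)=\eta(0)$ the following limits exist and are equal (commutativity): $$\lim_{s\downarrow0}\frac{d^2(\gamma(s),\eta(1))-d^2(\gamma(0),\eta(1))}{s}=\lim_{t\downarrow0}\frac{d^2(\eta(t),\gamma(1))-d^2(\eta(0),\gamma(1))}{t}.$$ Given $x_0\in D(\phi)$ and a partition $0=t^0<t^1<\cdots\to\infty$ of mesh $\sup_k(t^k-t^{k-1})$, a *discrete solution* from $x_0$ is a sequence $(x^k)_{k\ge0}$ with $x^0=x_0$ and $x^k\in J^\phi_{t^k-t^{k-1}}(x^{k-1})$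 for $k\ge1$. Its interpolation is the curve with value $x_0$ at $t=0$ and $x^k$ for $t\in(t^{k-1},t^k]$. Let $x_0\in D(\phi)$. Then all partitions of sufficiently small mesh admit a discrete solution from $x_0$, and there is a curve $\xi=\mathcal G(\cdot,x_0):[0,\infty)\to D(\phi)$ to which, for every sequence of partitions with mesh tending to $0$ and all associated discrete solutions from $x_0$, the interpolations converge uniformly on every bounded interval $[0,T]$. This (unique) curve satisfies $$\limsup_{\varepsilon\downarrow0}\frac{d^2(\xi(t+\varepsilon),y)-d^2(\xi(t),y)}{2\varepsilon}+\frac\lambda2d^2(\xi(t),y)+\phi(\xi(t))\le\phi(y)$$ for all $y\in D(\phi)$ and all $t>0$. In particular, for every $y\in D(\phi)$ and almost every $t>0$, the function $d^2(\xi(\cdot),y)$ is differentiable at $t$ and $$\frac12\frac{d}{dt}\big[d^2(\xi(t),y)\big]+\frac\lambda2d^2(\xi(t),y)+\phi(\xi(t))\le\phi(y).$$ -/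

import Mathlib

open Set Filter Topology MeasureTheory

noncomputable section

namespace EVIFlow

/-- `γ`, restricted to `[0,1]`, is a minimal geodesic of constant speed from `x` to `y` for the
distance function `δ` (values of `γ` outside `[0,1]` play no role). -/
def IsMinimalGeodesic {S : Type*} (δ : S → S → ℝ) (γ : ℝ → S) (x y : S) : Prop :=
  γ 0 = x ∧ γ 1 = y ∧
    ∀ s ∈ Icc (0 : ℝ) 1, ∀ t ∈ Icc (0 : ℝ) 1, δ (γ s) (γ t) = |s - t| * δ x y

/-- Any two points are joined by a minimal geodesic. -/
def IsGeodesicSpace (X : Type*) [MetricSpace X] : Prop :=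
  ∀ x y : X, ∃ γ : ℝ → X, IsMinimalGeodesic dist γ x y

/-- The unit sphere of Euclidean three-space. -/
abbrev UnitSphere : Type := Metric.sphere (0 : EuclideanSpace ℝ (Fin 3)) 1

/-- The intrinsic (angular) distance of the unit sphere. -/
def sphereDist (u v : UnitSphere) : ℝ :=
  InnerProductGeometry.angle (u : EuclideanSpace ℝ (Fin 3)) (v : EuclideanSpace ℝ (Fin 3))

/-- CAT(1)-spaces: geodesic triangles of perimeter less than `2π` are not thicker than their
comparison triangles in the unit sphere. -/
def IsCAT1 (X : Type*) [MetricSpace X] : Prop :=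
  IsGeodesicSpace X ∧
    ∀ x y z : X, dist x y + dist y z + dist z x < 2 * Real.pi →
      ∀ γ : ℝ → X, IsMinimalGeodesic dist γ y z →
        ∀ x' y' z' : UnitSphere,
          sphereDist x' y' = dist x y → sphereDist y' z' = dist y z →
          sphereDist z' x' = dist z x →
            ∀ γ' : ℝ → UnitSphere, IsMinimalGeodesic sphereDist γ' y' z' →
              ∀ t ∈ Icc (0 : ℝ) 1, dist x (γ t) ≤ sphereDist x' (γ' t)

section Potential

variable {X : Type*} [MetricSpace X]

/-- The proper domain `D(φ)` of `φ : X → (-∞, ∞]`. -/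
def domain (φ : X → EReal) : Set X := {x | φ x ≠ ⊤}

/-- The `κ`-convexity inequality of `f` along the curve `γ : [0,1] → X`. -/
def ConvexAlong (κ : ℝ) (f : X → EReal) (γ : ℝ → X) : Prop :=
  ∀ t ∈ Icc (0 : ℝ) 1,
    f (γ t) ≤ ((1 - t : ℝ) : EReal) * f (γ 0) + ((t : ℝ) : EReal) * f (γ 1)
      - ((κ / 2 * (1 - t) * t * dist (γ 0) (γ 1) ^ 2 : ℝ) : EReal)

/-- `φ` is `lam`-convex: any two points of `D(φ)` are joined by some minimal geodesic along which
the `lam`-convexity inequality holds. -/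
def IsLambdaConvex (lam : ℝ) (φ : X → EReal) : Prop :=
  ∀ x ∈ domain φ, ∀ y ∈ domain φ,
    ∃ γ : ℝ → X, IsMinimalGeodesic dist γ x y ∧ ConvexAlong lam φ γ

/-- The commutativity of two curves `γ, η` with a common origin: both one-sided derivatives
exist and they coincide. -/
def SqDistCommute (γ η : ℝ → X) : Prop :=
  ∃ L : ℝ,
    Tendsto (fun s : ℝ => (dist (γ s) (η 1) ^ 2 - dist (γ 0) (η 1) ^ 2) / s) (𝓝[>] 0) (𝓝 L) ∧
    Tendsto (fun s : ℝ => (dist (η s) (γ 1) ^ 2 - dist (η 0) (γ 1) ^ 2) / s) (𝓝[>] 0) (𝓝 L)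

/-- `Γ` is a family of minimal geodesics between points of `D(φ)`, joining any two of them, along
which `φ` is `lam`-convex, the squared distance functions `d²(z, ·)` are `K`-convex, and the
commutativity holds. -/
structure IsAdmissibleFamily (lam K : ℝ) (φ : X → EReal) (Γ : Set (ℝ → X)) : Prop where
  geodesic : ∀ γ ∈ Γ, γ 0 ∈ domain φ ∧ γ 1 ∈ domain φ ∧ IsMinimalGeodesic dist γ (γ 0) (γ 1)
  joins : ∀ x ∈ domain φ, ∀ y ∈ domain φ, ∃ γ ∈ Γ, γ 0 = x ∧ γ 1 = y
  potential_convex : ∀ γ ∈ Γ, ConvexAlong lam φ γ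
  sq_dist_convex : ∀ γ ∈ Γ, ∀ z ∈ domain φ,
    ConvexAlong K (fun w => ((dist z w ^ 2 : ℝ) : EReal)) γ
  commutativity : ∀ γ ∈ Γ, ∀ η ∈ Γ, γ 0 = η 0 → SqDistCommute γ η

/-- The Moreau–Yosida approximation `φ_τ`. -/
def moreauYosida (φ : X → EReal) (τ : ℝ) (x : X) : EReal :=
  ⨅ z : X, φ z + ((dist x z ^ 2 / (2 * τ) : ℝ) : EReal)

/-- The set `J_τ^φ(x)` of minimizers in the Moreau–Yosida approximation. -/
def minimizerSet (φ : X → EReal) (τ : ℝ) (x : X) : Set X :=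
  {z | φ z + ((dist x z ^ 2 / (2 * τ) : ℝ) : EReal) = moreauYosida φ τ x}

/-- Coercivity of `φ`. -/
def IsCoercive (φ : X → EReal) : Prop :=
  ∃ τs : ℝ, 0 < τs ∧ ∀ (x : X) (τ : ℝ), 0 < τ → τ < τs →
    ⊥ < moreauYosida φ τ x ∧ (minimizerSet φ τ x).Nonempty

/-- Partitions `0 = t⁰ < t¹ < ⋯ → ∞` of `[0, ∞)`. -/
structure TimePartition where
  pt : ℕ → ℝ
  pt_zero : pt 0 = 0
  strictMono : StrictMono pt
  unbounded : Tendsto pt atTop atTop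

/-- The mesh `|τ| = sup_k (t^k - t^{k-1}) ∈ [0, ∞]`. -/
def TimePartition.mesh (P : TimePartition) : ENNReal :=
  ⨆ k : ℕ, ENNReal.ofReal (P.pt (k + 1) - P.pt k)

/-- `x` is a discrete solution of the variational scheme for `φ`, `P` starting at `x₀`. -/
def IsDiscreteSolution (φ : X → EReal) (P : TimePartition) (x₀ : X) (x : ℕ → X) : Prop :=
  x 0 = x₀ ∧ ∀ k : ℕ, x (k + 1) ∈ minimizerSet φ (P.pt (k + 1) - P.pt k) (x k)

/-- The piecewise constant interpolation: `x 0` at time `0`, and `x k` on `(t^{k-1}, t^k]`. -/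
def interpolate (P : TimePartition) (x : ℕ → X) (t : ℝ) : X :=
  x (sInf {k : ℕ | t ≤ P.pt k})

/-- `ξ` (on `[0, ∞)`) is the gradient curve of `φ` starting at `x₀`: all sufficiently fine
partitions admit a discrete solution starting at `x₀`, and, whenever the mesh tends to zero, the
interpolated discrete solutions converge to `ξ` uniformly on bounded intervals. -/
def IsGradientCurve (φ : X → EReal) (x₀ : X) (ξ : ℝ → X) : Prop :=
  (∃ δ : ℝ, 0 < δ ∧ ∀ P : TimePartition, P.mesh < ENNReal.ofReal δ →
    ∃ x : ℕ → X, IsDiscreteSolution φ P x₀ x) ∧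
  ∀ (P : ℕ → TimePartition) (x : ℕ → ℕ → X),
    Tendsto (fun i => (P i).mesh) atTop (𝓝 0) →
    (∀ i, IsDiscreteSolution φ (P i) x₀ (x i)) →
    ∀ T : ℝ, TendstoUniformlyOn (fun i t => interpolate (P i) (x i) t) ξ atTop (Icc 0 T)

open Classical in
/-- The gradient flow `𝒢(t, x₀)`: the value at time `t ≥ 0` of the gradient curve starting at
`x₀` (and the default value `x₀` if there is no gradient curve). -/
def gradientFlow (φ : X → EReal) (t : ℝ) (x₀ : X) : X :=
  if h : ∃ ξ : ℝ → X, IsGradientCurve φ x₀ ξ then h.choose t else x₀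

end Potential

end EVIFlow

end

/-!
Testing the minimality of `z ∈ J_τ(x)` along a geodesic from `z` to `y` on which `φ` is `λ`-convex
bounds the slope of `d²(x, ·)` towards `y` at `z`. In Case II commutativity turns it into the slope
of `d²(·, y)` towards `x`, in Case I a comparison with the sphere does so up to an error
`C d²(x, z)`. Either way a step satisfies a discrete evolution variational inequality, whose error
is absorbed by the energy `φ(x) - φ(z)` dissipated in the step.

Testing the inequality of each of two discrete solutions at the points of the other gives a double
recursion for their mutual distances, and a Crandall–Liggett majorant shows that these vanish with
the meshes. Hence the interpolations converge; summing the one-step inequalities along the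
solutions and passing to the limit, with `φ` lower semicontinuous, yields the inequality for the
limit curve. In Case I minimizers exist because `d²` is uniformly convex on a `CAT(1)`-space of
diameter less than `π/2`, which makes minimizing sequences Cauchy.
-/

namespace EVIFlow

/-! ### The one-step evolution variational inequality -/

section OneStep

variable {X : Type*} [MetricSpace X] {φ : X → EReal}

section Minimizers

variable {τ : ℝ} {x y z : X}

theorem add_sq_dist_le_of_mem_minimizerSet (hz : z ∈ minimizerSet φ τ x) (y : X) :
    φ z + ((dist x z ^ 2 / (2 * τ) : ℝ) : EReal) ≤
      φ y + ((dist x y ^ 2 / (2 * τ) : ℝ) : EReal) :=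
  (show φ z + _ = moreauYosida φ τ x from hz).trans_le (iInf_le _ y)

theorem mem_domain_of_mem_minimizerSet (hz : z ∈ minimizerSet φ τ x) (hy : y ∈ domain φ) :
    z ∈ domain φ := by
  intro htop
  have h := add_sq_dist_le_of_mem_minimizerSet hz y
  rw [htop, EReal.top_add_coe, top_le_iff] at h
  exact EReal.add_ne_top hy (EReal.coe_ne_top _) h

theorem toReal_le_of_mem_minimizerSet (hbot : ∀ x, φ x ≠ ⊥) (hz : z ∈ minimizerSet φ τ x)
    (hy : y ∈ domain φ) :
    (φ z).toReal + dist x z ^ 2 / (2 * τ) ≤ (φ y).toReal + dist x y ^ 2 / (2 * τ) := by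
  have h := add_sq_dist_le_of_mem_minimizerSet hz y
  rw [← EReal.coe_toReal (mem_domain_of_mem_minimizerSet hz hy) (hbot z),
    ← EReal.coe_toReal hy (hbot y)] at h
  exact_mod_cast h

theorem two_mul_toReal_add_sq_dist_le (hbot : ∀ x, φ x ≠ ⊥) (hτ : 0 < τ)
    (hz : z ∈ minimizerSet φ τ x) (hy : y ∈ domain φ) :
    2 * τ * (φ z).toReal + dist x z ^ 2 ≤ 2 * τ * (φ y).toReal + dist x y ^ 2 := by
  have h := mul_le_mul_of_nonneg_left (toReal_le_of_mem_minimizerSet hbot hz hy)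
    (by positivity : 0 ≤ 2 * τ)
  rwa [mul_add, mul_add, mul_div_cancel₀ _ (by positivity), mul_div_cancel₀ _ (by positivity)] at h

end Minimizers

section Convexity

variable {κ : ℝ} {f : X → EReal} {γ : ℝ → X} {t : ℝ}

theorem ConvexAlong.le_coe (hbot : ∀ x, f x ≠ ⊥) (h : ConvexAlong κ f γ) (h0 : γ 0 ∈ domain f)
    (h1 : γ 1 ∈ domain f) (ht : t ∈ Icc (0 : ℝ) 1) :
    f (γ t) ≤ (((1 - t) * (f (γ 0)).toReal + t * (f (γ 1)).toReal
      - κ / 2 * (1 - t) * t * dist (γ 0) (γ 1) ^ 2 : ℝ) : EReal) := by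
  have hle := h t ht
  rw [← EReal.coe_toReal h0 (hbot _), ← EReal.coe_toReal h1 (hbot _)] at hle
  exact_mod_cast hle

theorem ConvexAlong.mem_domain (hbot : ∀ x, f x ≠ ⊥) (h : ConvexAlong κ f γ)
    (h0 : γ 0 ∈ domain f) (h1 : γ 1 ∈ domain f) (ht : t ∈ Icc (0 : ℝ) 1) : γ t ∈ domain f :=
  ne_top_of_le_ne_top (EReal.coe_ne_top _) (h.le_coe hbot h0 h1 ht)

theorem ConvexAlong.toReal_le (hbot : ∀ x, f x ≠ ⊥) (h : ConvexAlong κ f γ)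
    (h0 : γ 0 ∈ domain f) (h1 : γ 1 ∈ domain f) (ht : t ∈ Icc (0 : ℝ) 1) :
    (f (γ t)).toReal ≤ (1 - t) * (f (γ 0)).toReal + t * (f (γ 1)).toReal
      - κ / 2 * (1 - t) * t * dist (γ 0) (γ 1) ^ 2 := by
  have hle := h.le_coe hbot h0 h1 ht
  rw [← EReal.coe_toReal (h.mem_domain hbot h0 h1 ht) (hbot _)] at hle
  exact_mod_cast hle

theorem ConvexAlong.sq_dist_slope_le {V : ℝ} {z : X}
    (h : ConvexAlong κ (fun w => ((dist z w ^ 2 : ℝ) : EReal)) γ)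
    (hV : Tendsto (fun s : ℝ => (dist z (γ s) ^ 2 - dist z (γ 0) ^ 2) / s) (𝓝[>] 0) (𝓝 V)) :
    V ≤ dist z (γ 1) ^ 2 - dist z (γ 0) ^ 2 - κ / 2 * dist (γ 0) (γ 1) ^ 2 := by
  have hlim : Tendsto (fun s : ℝ => dist z (γ 1) ^ 2 - dist z (γ 0) ^ 2
      - κ / 2 * (1 - s) * dist (γ 0) (γ 1) ^ 2) (𝓝[>] 0)
      (𝓝 (dist z (γ 1) ^ 2 - dist z (γ 0) ^ 2 - κ / 2 * dist (γ 0) (γ 1) ^ 2)) :=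
    ((Continuous.tendsto' (by fun_prop) 0 _ (by ring))).mono_left nhdsWithin_le_nhds
  refine le_of_tendsto_of_tendsto hV hlim ?_
  filter_upwards [Ioo_mem_nhdsGT (zero_lt_one' ℝ)] with s hs
  have hc := h.toReal_le (fun _ => EReal.coe_ne_bot _) (EReal.coe_ne_top _)
    (EReal.coe_ne_top _) ⟨hs.1.le, hs.2.le⟩
  simp only [EReal.toReal_coe] at hc
  rw [div_le_iff₀ hs.1]
  linarith

end Convexity

variable {lam C K : ℝ}

/-- The right-hand side `2 (φ(y) - φ(w)) - lam d²(w, y)` of the evolution variational inequality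
for `d²(·, y)` at the point `w`; it is meaningful for `w, y ∈ D(φ)`. -/
def eviRate (lam : ℝ) (φ : X → EReal) (y w : X) : ℝ :=
  2 * ((φ y).toReal - (φ w).toReal) - lam * dist w y ^ 2

/-- The one-step evolution variational inequality of the minimizing movement scheme, with an
error controlled by the squared step length. -/
def OneStepEVI (lam C : ℝ) (φ : X → EReal) : Prop :=
  ∀ x ∈ domain φ, ∀ τ : ℝ, 0 < τ → ∀ z ∈ minimizerSet φ τ x, ∀ y ∈ domain φ,
    dist z y ^ 2 - dist x y ^ 2 ≤ τ * eviRate lam φ y z + C * dist x z ^ 2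

theorem neg_mul_eviRate_le_of_mem_minimizerSet (hbot : ∀ x, φ x ≠ ⊥) {τ V : ℝ} (hτ : 0 < τ)
    {x : X} {γ : ℝ → X} (hmin : γ 0 ∈ minimizerSet φ τ x) (h1 : γ 1 ∈ domain φ)
    (hconv : ConvexAlong lam φ γ)
    (hV : ∀ v > V, ∀ᶠ s in 𝓝[>] (0 : ℝ), (dist x (γ s) ^ 2 - dist x (γ 0) ^ 2) / s ≤ v) :
    -(τ * eviRate lam φ (γ 1) (γ 0)) ≤ V := by
  have h0 := mem_domain_of_mem_minimizerSet hmin h1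
  refine le_of_forall_gt_imp_ge_of_dense fun v hv => ?_
  have hlim : Tendsto (fun s : ℝ => τ * (lam * (1 - s) * dist (γ 0) (γ 1) ^ 2
      - 2 * ((φ (γ 1)).toReal - (φ (γ 0)).toReal))) (𝓝[>] 0)
      (𝓝 (-(τ * eviRate lam φ (γ 1) (γ 0)))) :=
    (Continuous.tendsto' (by fun_prop) 0 _ (by rw [eviRate]; ring)).mono_left nhdsWithin_le_nhds
  refine le_of_tendsto hlim ?_
  filter_upwards [hV v hv, Ioo_mem_nhdsGT (zero_lt_one' ℝ)] with s hs hs01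
  rw [div_le_iff₀ hs01.1] at hs
  have ht : s ∈ Icc (0 : ℝ) 1 := ⟨hs01.1.le, hs01.2.le⟩
  have hm := two_mul_toReal_add_sq_dist_le hbot hτ hmin (hconv.mem_domain hbot h0 h1 ht)
  have hc := mul_le_mul_of_nonneg_left (hconv.toReal_le hbot h0 h1 ht) (by positivity : 0 ≤ 2 * τ)
  refine le_of_mul_le_mul_left ?_ hs01.1
  linarith

/-- Commutativity trades the slope of `d²(x, ·)` towards `y`, controlled by minimality, for the
slope of `d²(y, ·)` towards `x`, controlled by semi-convexity. -/
theorem IsAdmissibleFamily.oneStepEVI {Γ : Set (ℝ → X)} (hbot : ∀ x, φ x ≠ ⊥)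
    (hΓ : IsAdmissibleFamily lam K φ Γ) : OneStepEVI lam (|K| / 2) φ := by
  intro x hx τ hτ z hz y hy
  have hzd := mem_domain_of_mem_minimizerSet hz hy
  obtain ⟨γ, hγ, rfl, rfl⟩ := hΓ.joins z hzd y hy
  obtain ⟨η, hη, hηγ, rfl⟩ := hΓ.joins (γ 0) hzd x hx
  obtain ⟨V, hVγ, hVη⟩ := hΓ.commutativity γ hγ η hη hηγ.symm
  simp only [dist_comm _ (η 1), dist_comm _ (γ 1)] at hVγ hVη
  have hmin := neg_mul_eviRate_le_of_mem_minimizerSet hbot hτ hz hy (hΓ.potential_convex γ hγ)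
    fun v hv => hVγ.eventually_le_const hv
  have hconv := (hΓ.sq_dist_convex η hη (γ 1) hy).sq_dist_slope_le hVη
  rw [hηγ, dist_comm (γ 0) (η 1)] at hconv
  have hK : -(K / 2 * dist (η 1) (γ 0) ^ 2) ≤ |K| / 2 * dist (η 1) (γ 0) ^ 2 := by
    nlinarith [neg_abs_le K, sq_nonneg (dist (η 1) (γ 0))]
  rw [dist_comm (γ 0) (γ 1), dist_comm (η 1) (γ 1)]
  linarith

end OneStep

/-! ### Discrete Gronwall and Crandall–Liggett recursions -/

section Recursions

theorem exp_neg_le_one_sub_half {y : ℝ} (h0 : 0 ≤ y) (h1 : y ≤ 1) :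
    Real.exp (-y) ≤ 1 - y / 2 := by
  rw [Real.exp_neg]
  refine inv_le_of_inv_le₀ (by linarith) (le_trans ?_ (Real.add_one_le_exp y))
  rw [inv_le_iff_one_le_mul₀ (by linarith)]
  nlinarith

theorem le_exp_mul_of_implicit_recursion {t c : ℕ → ℝ} {α h : ℝ} (hα : 0 ≤ α)
    (hh : 2 * α * h ≤ 1) (hc0 : 0 ≤ c 0) (ht : Monotone t) (hmesh : ∀ k, t (k + 1) - t k ≤ h)
    (hrec : ∀ k, c (k + 1) ≤ c k + α * (t (k + 1) - t k) * c (k + 1)) (k : ℕ) :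
    c k ≤ Real.exp (2 * α * (t k - t 0)) * c 0 := by
  induction k with
  | zero => simp
  | succ k ih =>
    set τ := t (k + 1) - t k with hτ
    have hτ0 : 0 ≤ 2 * α * τ := mul_nonneg (by positivity) (sub_nonneg.2 (ht k.le_succ))
    have hτ1 : 2 * α * τ ≤ 1 := (mul_le_mul_of_nonneg_left (hmesh k) (by positivity)).trans hh
    refine le_of_mul_le_mul_left ?_ (by linarith : 0 < 1 - α * τ)
    calc (1 - α * τ) * c (k + 1) ≤ c k := by linarith [hrec k]
      _ ≤ Real.exp (2 * α * (t k - t 0)) * c 0 := ih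
      _ = Real.exp (-(2 * α * τ)) * (Real.exp (2 * α * (t (k + 1) - t 0)) * c 0) := by
          rw [← mul_assoc, ← Real.exp_add, hτ]; ring_nf
      _ ≤ (1 - α * τ) * (Real.exp (2 * α * (t (k + 1) - t 0)) * c 0) := by
          refine mul_le_mul_of_nonneg_right ?_ (by positivity)
          linarith [exp_neg_le_one_sub_half hτ0 hτ1]

theorem TimePartition.pt_nonneg (P : TimePartition) (k : ℕ) : 0 ≤ P.pt k :=
  P.pt_zero ▸ P.strictMono.monotone k.zero_le

theorem TimePartition.step_pos (P : TimePartition) (k : ℕ) : 0 < P.pt (k + 1) - P.pt k :=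
  sub_pos.2 (P.strictMono k.lt_succ_self)

theorem le_of_double_recursion {a b p q r e : ℕ → ℕ → ℝ} {I J : ℕ} (hp : ∀ i j, 0 ≤ p i j)
    (hq : ∀ i j, 0 ≤ q i j) (hr : ∀ i j, 0 < r i j)
    (ha : ∀ i j, r i j * a (i + 1) (j + 1) ≤ p i j * a i (j + 1) + q i j * a (i + 1) j + e i j)
    (hb : ∀ i j, p i j * b i (j + 1) + q i j * b (i + 1) j + e i j ≤ r i j * b (i + 1) (j + 1))
    (hI : ∀ i ≤ I, a i 0 ≤ b i 0) (hJ : ∀ j ≤ J, a 0 j ≤ b 0 j) {i j : ℕ} (hi : i ≤ I)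
    (hj : j ≤ J) : a i j ≤ b i j := by
  induction i generalizing j with
  | zero => exact hJ j hj
  | succ i ihi =>
    induction j with
    | zero => exact hI _ hi
    | succ j ihj =>
      refine le_of_mul_le_mul_left ((ha i j).trans (le_trans ?_ (hb i j))) (hr i j)
      have hrow := mul_le_mul_of_nonneg_left (ihi (Nat.le_of_succ_le hi) hj) (hp i j)
      have hcol := mul_le_mul_of_nonneg_left (ihj (Nat.le_of_succ_le hj)) (hq i j)
      linarith

theorem mul_sqrt_add_mul_sqrt_le {σ τ p q r : ℝ} (hσ : 0 < σ) (hτ : 0 < τ) (hp : 0 ≤ p)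
    (hq : 0 ≤ q) (h : σ * p + τ * q ≤ (σ + τ) * r) : σ * √p + τ * √q ≤ (σ + τ) * √r := by
  have hστ : 0 < σ + τ := add_pos hσ hτ
  have hconc := Real.strictConcaveOn_sqrt.concaveOn.2 hp hq (div_pos hσ hστ).le
    (div_pos hτ hστ).le (by field_simp)
  have hmean : σ / (σ + τ) * p + τ / (σ + τ) * q ≤ r := by
    rw [div_mul_eq_mul_div, div_mul_eq_mul_div, ← add_div, div_le_iff₀ hστ]
    linarith
  have hsqrt := hconc.trans (Real.sqrt_le_sqrt hmean)
  rw [smul_eq_mul, smul_eq_mul, div_mul_eq_mul_div, div_mul_eq_mul_div, ← add_div,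
    div_le_iff₀ hστ] at hsqrt
  linarith

/-- The majorant of Crandall–Liggett type at the times `t`, `s` of two grids of mesh at most `h`;
`e` stands for the total energy dissipated up to these times, `D` weighs the one-step errors, and
`4 μ` compensates a concavity of order `μ` of the energy. -/
noncomputable def crandallLiggettBound (μ c D h t s e : ℝ) : ℝ :=
  Real.exp (4 * μ * (t + s)) * (c * √((t - s) ^ 2 + h * (t + s)) + D * h * e)

variable {μ c D h t s τ σ e α β : ℝ}

theorem mul_abs_sub_le_crandallLiggettBound (hμ : 0 ≤ μ) (hc : 0 ≤ c) (hD : 0 ≤ D) (hh : 0 ≤ h)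
    (hts : 0 ≤ t + s) (he : 0 ≤ e) : c * |t - s| ≤ crandallLiggettBound μ c D h t s e := by
  refine le_trans ?_ (le_mul_of_one_le_left (by positivity) (Real.one_le_exp (by positivity)))
  have habs : |t - s| ≤ √((t - s) ^ 2 + h * (t + s)) :=
    Real.abs_le_sqrt (le_add_of_nonneg_right (by positivity))
  exact le_add_of_le_of_nonneg (by gcongr) (by positivity)

theorem crandallLiggettBound_core_superharmonic (hc : 0 ≤ c) (hD : 0 ≤ D) (ht : 0 ≤ t)
    (hs : 0 ≤ s) (hτ : 0 < τ) (hσ : 0 < σ) (hτh : τ ≤ h) (hσh : σ ≤ h) (hα : 0 ≤ α)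
    (hβ : 0 ≤ β) :
    σ * (c * √((t - (s + σ)) ^ 2 + h * (t + (s + σ))) + D * h * (e + β))
        + τ * (c * √((t + τ - s) ^ 2 + h * (t + τ + s)) + D * h * (e + α)) + D * τ * σ * (α + β)
      ≤ (σ + τ) * (c * √((t + τ - (s + σ)) ^ 2 + h * (t + τ + (s + σ)))
        + D * h * (e + α + β)) := by
  have hh : 0 ≤ h := hτ.le.trans hτh
  have hsqrt := mul_sqrt_add_mul_sqrt_le hσ hτ
    (p := (t - (s + σ)) ^ 2 + h * (t + (s + σ))) (q := (t + τ - s) ^ 2 + h * (t + τ + s))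
    (r := (t + τ - (s + σ)) ^ 2 + h * (t + τ + (s + σ))) (by positivity) (by positivity) (by
      have : 0 ≤ τ * σ * (2 * h - τ - σ) := mul_nonneg (by positivity) (by linarith)
      linarith)
  have hα' : 0 ≤ D * σ * α * (h - τ) := mul_nonneg (by positivity) (by linarith)
  have hβ' : 0 ≤ D * τ * β * (h - σ) := mul_nonneg (by positivity) (by linarith)
  linarith [mul_le_mul_of_nonneg_left hsqrt hc]

theorem exp_neg_min_mul_add_le (hμ : 0 ≤ μ) (hτ : 0 < τ) (hσ : 0 < σ) (hμτ : 4 * μ * τ ≤ 1) :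
    Real.exp (-(4 * μ * min τ σ)) * (σ + τ) ≤ σ + τ - 2 * μ * τ * σ := by
  have hm : 0 < min τ σ := lt_min hτ hσ
  have hm1 : 4 * μ * min τ σ ≤ 1 :=
    (mul_le_mul_of_nonneg_left (min_le_left τ σ) (by positivity)).trans hμτ
  have hmul : τ * σ ≤ min τ σ * (σ + τ) := by
    rw [← min_mul_max τ σ]
    exact mul_le_mul_of_nonneg_left (max_le (by linarith) (by linarith)) hm.le
  have hexp := mul_le_mul_of_nonneg_right (exp_neg_le_one_sub_half (by positivity) hm1)
    (add_pos hσ hτ).le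
  linarith [mul_le_mul_of_nonneg_left hmul hμ]

theorem crandallLiggettBound_superharmonic (hμ : 0 ≤ μ) (hc : 0 ≤ c) (hD : 0 ≤ D)
    (hμh : 4 * μ * h ≤ 1) (ht : 0 ≤ t) (hs : 0 ≤ s) (hτ : 0 < τ) (hσ : 0 < σ) (hτh : τ ≤ h)
    (hσh : σ ≤ h) (he : 0 ≤ e) (hα : 0 ≤ α) (hβ : 0 ≤ β) :
    σ * crandallLiggettBound μ c D h t (s + σ) (e + β)
        + τ * crandallLiggettBound μ c D h (t + τ) s (e + α) + D * τ * σ * (α + β)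
      ≤ (σ + τ - 2 * μ * τ * σ) *
        crandallLiggettBound μ c D h (t + τ) (s + σ) (e + α + β) := by
  have hh : 0 ≤ h := hτ.le.trans hτh
  have hμτ : 4 * μ * τ ≤ 1 := (mul_le_mul_of_nonneg_left hτh (by positivity)).trans hμh
  set W := Real.exp (4 * μ * (t + τ + (s + σ))) with hW
  set ε := Real.exp (-(4 * μ * min τ σ)) with hε
  have hexp : ∀ r, r + min τ σ ≤ t + τ + (s + σ) → Real.exp (4 * μ * r) ≤ ε * W := by
    intro r hr
    rw [hε, hW, ← Real.exp_add, Real.exp_le_exp]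
    linarith [mul_le_mul_of_nonneg_left hr hμ]
  have hone : 1 ≤ ε * W := by
    simpa using hexp 0 (by linarith [min_le_left τ σ])
  simp only [crandallLiggettBound]
  calc _ ≤ σ * (ε * W * (c * √((t - (s + σ)) ^ 2 + h * (t + (s + σ))) + D * h * (e + β)))
        + τ * (ε * W * (c * √((t + τ - s) ^ 2 + h * (t + τ + s)) + D * h * (e + α)))
        + ε * W * (D * τ * σ * (α + β)) := by
        refine add_le_add ?_ (le_mul_of_one_le_left (by positivity) hone)
        gcongr
        · exact hexp _ (by linarith [min_le_left τ σ])
        · exact hexp _ (by linarith [min_le_right τ σ])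
    _ ≤ ε * W * ((σ + τ) * (c * √((t + τ - (s + σ)) ^ 2 + h * (t + τ + (s + σ)))
        + D * h * (e + α + β))) := by
        refine le_trans (le_of_eq ?_) (mul_le_mul_of_nonneg_left
          (crandallLiggettBound_core_superharmonic hc hD ht hs hτ hσ hτh hσh hα hβ) (by positivity))
        ring
    _ = (ε * (σ + τ)) * (W * (c * √((t + τ - (s + σ)) ^ 2 + h * (t + τ + (s + σ)))
        + D * h * (e + α + β))) := by ring
    _ ≤ _ := mul_le_mul_of_nonneg_right (exp_neg_min_mul_add_le hμ hτ hσ hμτ) (by positivity)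

variable {P Q : TimePartition}

theorem le_crandallLiggettBound {f g : ℕ → ℝ} {a : ℕ → ℕ → ℝ} {I J : ℕ} (hμ : 0 ≤ μ)
    (hc : 0 ≤ c) (hD : 0 ≤ D) (hμh : 4 * μ * h ≤ 1) (hPh : ∀ k, P.pt (k + 1) - P.pt k ≤ h)
    (hQh : ∀ k, Q.pt (k + 1) - Q.pt k ≤ h) (hf : Antitone f) (hg : Antitone g)
    (hrec : ∀ i j, ((Q.pt (j + 1) - Q.pt j) + (P.pt (i + 1) - P.pt i)
        - 2 * μ * (P.pt (i + 1) - P.pt i) * (Q.pt (j + 1) - Q.pt j)) * a (i + 1) (j + 1)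
      ≤ (Q.pt (j + 1) - Q.pt j) * a i (j + 1) + (P.pt (i + 1) - P.pt i) * a (i + 1) j
        + D * (P.pt (i + 1) - P.pt i) * (Q.pt (j + 1) - Q.pt j)
          * ((f i - f (i + 1)) + (g j - g (j + 1))))
    (hI : ∀ i ≤ I, a i 0 ≤ c * P.pt i) (hJ : ∀ j ≤ J, a 0 j ≤ c * Q.pt j) {i j : ℕ}
    (hi : i ≤ I) (hj : j ≤ J) :
    a i j ≤ crandallLiggettBound μ c D h (P.pt i) (Q.pt j) ((f 0 - f i) + (g 0 - g j)) := by
  have he : ∀ i j, 0 ≤ (f 0 - f i) + (g 0 - g j) := fun i j =>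
    add_nonneg (sub_nonneg.2 (hf i.zero_le)) (sub_nonneg.2 (hg j.zero_le))
  have hh : 0 ≤ h := (P.step_pos 0).le.trans (hPh 0)
  have hbdry : ∀ i j, c * |P.pt i - Q.pt j| ≤
      crandallLiggettBound μ c D h (P.pt i) (Q.pt j) ((f 0 - f i) + (g 0 - g j)) := fun i j =>
    mul_abs_sub_le_crandallLiggettBound hμ hc hD hh
      (add_nonneg (P.pt_nonneg i) (Q.pt_nonneg j)) (he i j)
  refine le_of_double_recursion
    (b := fun i j => crandallLiggettBound μ c D h (P.pt i) (Q.pt j) ((f 0 - f i) + (g 0 - g j)))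
    (fun _ j => (Q.step_pos j).le) (fun i _ => (P.step_pos i).le) (fun i j => ?_) hrec
    (fun i j => ?_) (fun i hi => (hI i hi).trans ?_) (fun j hj => (hJ j hj).trans ?_) hi hj
  · refine lt_of_lt_of_le ?_ (exp_neg_min_mul_add_le hμ (P.step_pos i) (Q.step_pos j)
      ((mul_le_mul_of_nonneg_left (hPh i) (by positivity)).trans hμh))
    exact mul_pos (Real.exp_pos _) (add_pos (Q.step_pos j) (P.step_pos i))
  · have hsuper := crandallLiggettBound_superharmonic hμ hc hD hμh (P.pt_nonneg i) (Q.pt_nonneg j)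
      (P.step_pos i) (Q.step_pos j) (hPh i) (hQh j) (he i j)
      (sub_nonneg.2 (hf (i.le_add_right 1))) (sub_nonneg.2 (hg (j.le_add_right 1)))
    have hef : ∀ i r, f 0 - f i + r + (f i - f (i + 1)) = f 0 - f (i + 1) + r := by intros; ring
    have heg : ∀ j r, r + (g 0 - g j) + (g j - g (j + 1)) = r + (g 0 - g (j + 1)) := by
      intros; ring
    simpa only [add_sub_cancel, hef, heg] using hsuper
  · simpa [Q.pt_zero, abs_of_nonneg (P.pt_nonneg i)] using hbdry i 0
  · simpa [P.pt_zero, abs_of_nonneg (Q.pt_nonneg j)] using hbdry 0 j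

end Recursions

/-! ### Comparison of discrete solutions -/

section DiscreteSolutions

variable {X : Type*} [MetricSpace X] {φ : X → EReal} {x₀ : X} {x y : ℕ → X} {P Q : TimePartition}

theorem TimePartition.step_le_of_mesh_le (P : TimePartition) {h : ℝ}
    (hP : P.mesh ≤ ENNReal.ofReal h) (k : ℕ) : P.pt (k + 1) - P.pt k ≤ h :=
  (ENNReal.ofReal_le_ofReal_iff'.1 ((le_iSup _ k).trans hP)).resolve_right (P.step_pos k).not_ge

namespace IsDiscreteSolution

theorem mem_domain (hx : IsDiscreteSolution φ P x₀ x) (hx₀ : x₀ ∈ domain φ) (k : ℕ) :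
    x k ∈ domain φ := by
  cases k with
  | zero => exact hx.1 ▸ hx₀
  | succ k => exact mem_domain_of_mem_minimizerSet (hx.2 k) hx₀

theorem sq_dist_step_le (hbot : ∀ x, φ x ≠ ⊥) (hx : IsDiscreteSolution φ P x₀ x)
    (hx₀ : x₀ ∈ domain φ) (k : ℕ) :
    dist (x k) (x (k + 1)) ^ 2
      ≤ 2 * ((φ (x k)).toReal - (φ (x (k + 1))).toReal) * (P.pt (k + 1) - P.pt k) := by
  have h := two_mul_toReal_add_sq_dist_le hbot (P.step_pos k) (hx.2 k) (hx.mem_domain hx₀ k)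
  rw [dist_self] at h
  linarith

theorem toReal_antitone (hbot : ∀ x, φ x ≠ ⊥) (hx : IsDiscreteSolution φ P x₀ x)
    (hx₀ : x₀ ∈ domain φ) : Antitone fun k => (φ (x k)).toReal := by
  refine antitone_nat_of_succ_le fun k => ?_
  have h := (sq_nonneg _).trans (hx.sq_dist_step_le hbot hx₀ k)
  linarith [nonneg_of_mul_nonneg_left h (P.step_pos k)]

theorem toReal_le (hbot : ∀ x, φ x ≠ ⊥) (hx : IsDiscreteSolution φ P x₀ x)
    (hx₀ : x₀ ∈ domain φ) (k : ℕ) : (φ (x k)).toReal ≤ (φ x₀).toReal :=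
  hx.1 ▸ hx.toReal_antitone hbot hx₀ k.zero_le

end IsDiscreteSolution

theorem add_sq_le_of_sq_le {a b t τ e ε : ℝ} (ht : 0 ≤ t) (hτ : 0 ≤ τ) (he : 0 ≤ e) (hε : 0 ≤ ε)
    (ha : a ^ 2 ≤ 2 * e * t) (hb : b ^ 2 ≤ 2 * ε * τ) :
    (a + b) ^ 2 ≤ 2 * (e + ε) * (t + τ) := by
  have hcross : a * b ≤ t * ε + τ * e := by
    refine (abs_le_of_sq_le_sq' ?_ (by positivity)).2
    calc (a * b) ^ 2 = a ^ 2 * b ^ 2 := mul_pow a b 2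
      _ ≤ (2 * e * t) * (2 * ε * τ) := by gcongr
      _ ≤ (t * ε + τ * e) ^ 2 := by linarith [sq_nonneg (t * ε - τ * e)]
  linarith

theorem IsDiscreteSolution.sq_dist_le (hbot : ∀ x, φ x ≠ ⊥) (hx : IsDiscreteSolution φ P x₀ x)
    (hx₀ : x₀ ∈ domain φ) (k : ℕ) :
    dist x₀ (x k) ^ 2 ≤ 2 * ((φ x₀).toReal - (φ (x k)).toReal) * P.pt k := by
  induction k with
  | zero => simp [hx.1, P.pt_zero]
  | succ k ih =>
    calc dist x₀ (x (k + 1)) ^ 2 ≤ (dist x₀ (x k) + dist (x k) (x (k + 1))) ^ 2 := by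
          gcongr; exact dist_triangle _ _ _
      _ ≤ 2 * (((φ x₀).toReal - (φ (x k)).toReal) + ((φ (x k)).toReal - (φ (x (k + 1))).toReal))
          * (P.pt k + (P.pt (k + 1) - P.pt k)) :=
        add_sq_le_of_sq_le (P.pt_nonneg k) (P.step_pos k).le
          (sub_nonneg.2 (hx.toReal_le hbot hx₀ k))
          (sub_nonneg.2 (hx.toReal_antitone hbot hx₀ (k.le_add_right 1))) ih
          (hx.sq_dist_step_le hbot hx₀ k)
      _ = 2 * ((φ x₀).toReal - (φ (x (k + 1))).toReal) * P.pt (k + 1) := by ring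

theorem sq_le_sq_add_of_le_add {a b s η : ℝ} (ha : 0 ≤ a) (hb : 0 ≤ b) (hs : 0 ≤ s) (hη : 0 < η)
    (h : a ≤ b + s) : a ^ 2 ≤ b ^ 2 + s ^ 2 / η + η * a ^ 2 := by
  have hyoung : 2 * s * a ≤ s ^ 2 / η + η * a ^ 2 := by
    rw [← sub_nonneg]
    have : s ^ 2 / η + η * a ^ 2 - 2 * s * a = (s - η * a) ^ 2 / η := by field_simp; ring
    rw [this]
    positivity
  have hle : a ^ 2 ≤ b ^ 2 + 2 * s * a := by
    rcases le_total a b with hab | hab <;> nlinarith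
  linarith

/-- The quadratic lower bound makes `d²(x^k, x₀) + 2ε (φ(x^k) + A)` comparable to `d²(x^k, x₀)`,
and the energy dissipated in a step pays for the increase of the distance. -/
theorem IsDiscreteSolution.implicit_recursion (hbot : ∀ x, φ x ≠ ⊥)
    (hx : IsDiscreteSolution φ P x₀ x) (hx₀ : x₀ ∈ domain φ) {A B ε : ℝ} (hε : 0 < ε)
    (hεB : 4 * B * ε ≤ 1) (hlow : ∀ z ∈ domain φ, -A - B * dist x₀ z ^ 2 ≤ (φ z).toReal) {c : ℕ → ℝ}
    (hc : ∀ k, c k = dist x₀ (x k) ^ 2 + 2 * ε * ((φ (x k)).toReal + A)) (k : ℕ) :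
    dist x₀ (x k) ^ 2 ≤ 2 * c k ∧
      c (k + 1) ≤ c k + 2 / ε * (P.pt (k + 1) - P.pt k) * c (k + 1) := by
  have hdist : ∀ k, dist x₀ (x k) ^ 2 ≤ 2 * c k := fun k => by
    have hbelow := mul_le_mul_of_nonneg_left (hlow _ (hx.mem_domain hx₀ k))
      (by positivity : 0 ≤ 4 * ε)
    have habsorb := mul_le_mul_of_nonneg_right hεB (sq_nonneg (dist x₀ (x k)))
    rw [hc]
    linarith
  refine ⟨hdist k, ?_⟩
  have hτ := P.step_pos k
  set τ := P.pt (k + 1) - P.pt k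
  have hgrowth := sq_le_sq_add_of_le_add dist_nonneg dist_nonneg dist_nonneg (div_pos hτ hε)
    (dist_triangle x₀ (x k) (x (k + 1)))
  have hstep : dist (x k) (x (k + 1)) ^ 2 / (τ / ε)
      ≤ 2 * ε * ((φ (x k)).toReal - (φ (x (k + 1))).toReal) := by
    rw [div_le_iff₀ (by positivity)]
    refine (hx.sq_dist_step_le hbot hx₀ k).trans_eq ?_
    field_simp
    ring
  have hself : τ / ε * dist x₀ (x (k + 1)) ^ 2 ≤ 2 / ε * τ * c (k + 1) :=
    (mul_le_mul_of_nonneg_left (hdist (k + 1)) (by positivity)).trans_eq (by ring)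
  linarith [hc k, hc (k + 1)]

theorem exists_lower_bound_discreteSolution (hbot : ∀ x, φ x ≠ ⊥) (hx₀ : x₀ ∈ domain φ)
    {A B : ℝ} (hB : 0 ≤ B) (hlow : ∀ z ∈ domain φ, -A - B * dist x₀ z ^ 2 ≤ (φ z).toReal) (T : ℝ) :
    ∃ h > 0, ∃ M : ℝ, ∀ (P : TimePartition) (x : ℕ → X), IsDiscreteSolution φ P x₀ x →
      P.mesh ≤ ENNReal.ofReal h → ∀ k, P.pt k ≤ T → -M ≤ (φ (x k)).toReal := by
  set ε := 1 / (4 * B + 1)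
  have hε : 0 < ε := by positivity
  have hεB : 4 * B * ε ≤ 1 := by
    rw [mul_one_div, div_le_one (by positivity)]
    linarith
  set c₀ := 2 * ε * ((φ x₀).toReal + A)
  have hc₀ : 0 ≤ c₀ := by
    have := hlow x₀ hx₀
    rw [dist_self] at this
    exact mul_nonneg (by positivity) (by linarith)
  refine ⟨ε / 4, by positivity, A + B * (2 * (Real.exp (2 * (2 / ε) * T) * c₀)),
    fun P x hx hmesh k hk => ?_⟩
  set c : ℕ → ℝ := fun k => dist x₀ (x k) ^ 2 + 2 * ε * ((φ (x k)).toReal + A)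
  have hc0 : c 0 = c₀ := by simp [c, c₀, hx.1]
  have hrec := hx.implicit_recursion hbot hx₀ hε hεB hlow (c := c) fun _ => rfl
  have hgronwall : c k ≤ Real.exp (2 * (2 / ε) * T) * c₀ := by
    refine (le_exp_mul_of_implicit_recursion (by positivity) (h := ε / 4)
      (by field_simp; norm_num) (hc0 ▸ hc₀) P.strictMono.monotone (P.step_le_of_mesh_le hmesh)
      (fun k => (hrec k).2) k).trans ?_
    rw [P.pt_zero, sub_zero, hc0]
    gcongr
  have hdist := mul_le_mul_of_nonneg_left ((hrec k).1.trans
    (mul_le_mul_of_nonneg_left hgronwall zero_le_two)) hB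
  linarith [hlow _ (hx.mem_domain hx₀ k)]

/-- The setting of the convergence theory: the minimizing movement scheme for `φ` is solvable for
all small steps, its steps satisfy the one-step evolution variational inequality, and `φ` decays
at most quadratically away from the initial point `x₀ ∈ D(φ)`. -/
structure IsEVIPotential (lam C : ℝ) (φ : X → EReal) (x₀ : X) : Prop where
  ne_bot : ∀ x, φ x ≠ ⊥
  lowerSemicontinuous : LowerSemicontinuous φ
  mem_domain : x₀ ∈ domain φ
  error_nonneg : 0 ≤ C
  oneStepEVI : OneStepEVI lam C φ
  exists_quadratic_lower_bound :
    ∃ A B : ℝ, 0 ≤ B ∧ ∀ z ∈ domain φ, -A - B * dist x₀ z ^ 2 ≤ (φ z).toReal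
  exists_minimizer : ∃ δ > 0, ∀ x ∈ domain φ, ∀ τ : ℝ, 0 < τ → τ < δ → (minimizerSet φ τ x).Nonempty

variable {lam C : ℝ}

/-- The one-step inequality of each solution is tested at the new point of the other one. -/
theorem IsEVIPotential.sq_dist_double_recursion (hφ : IsEVIPotential lam C φ x₀)
    (hx : IsDiscreteSolution φ P x₀ x) (hy : IsDiscreteSolution φ Q x₀ y) (i j : ℕ) :
    ((Q.pt (j + 1) - Q.pt j) + (P.pt (i + 1) - P.pt i)
        - 2 * |lam| * (P.pt (i + 1) - P.pt i) * (Q.pt (j + 1) - Q.pt j))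
          * dist (x (i + 1)) (y (j + 1)) ^ 2
      ≤ (Q.pt (j + 1) - Q.pt j) * dist (x i) (y (j + 1)) ^ 2
        + (P.pt (i + 1) - P.pt i) * dist (x (i + 1)) (y j) ^ 2
        + 2 * C * (P.pt (i + 1) - P.pt i) * (Q.pt (j + 1) - Q.pt j)
          * (((φ (x i)).toReal - (φ (x (i + 1))).toReal)
            + ((φ (y j)).toReal - (φ (y (j + 1))).toReal)) := by
  have hτ := P.step_pos i
  have hσ := Q.step_pos j
  have ex := hφ.oneStepEVI _ (hx.mem_domain hφ.mem_domain i) _ hτ _ (hx.2 i) _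
    (hy.mem_domain hφ.mem_domain (j + 1))
  have ey := hφ.oneStepEVI _ (hy.mem_domain hφ.mem_domain j) _ hσ _ (hy.2 j) _
    (hx.mem_domain hφ.mem_domain (i + 1))
  rw [dist_comm (y (j + 1)), dist_comm (y j) (x (i + 1))] at ey
  have sx := mul_le_mul_of_nonneg_left (hx.sq_dist_step_le hφ.ne_bot hφ.mem_domain i)
    hφ.error_nonneg
  have sy := mul_le_mul_of_nonneg_left (hy.sq_dist_step_le hφ.ne_bot hφ.mem_domain j)
    hφ.error_nonneg
  set τ := P.pt (i + 1) - P.pt i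
  set σ := Q.pt (j + 1) - Q.pt j
  have ex' := mul_le_mul_of_nonneg_left (ex.trans (add_le_add_right sx _)) hσ.le
  have ey' := mul_le_mul_of_nonneg_left (ey.trans (add_le_add_right sy _)) hτ.le
  rw [eviRate] at ex' ey'
  rw [dist_comm (y (j + 1))] at ey'
  have hlam : 0 ≤ (|lam| + lam) * (2 * (τ * σ) * dist (x (i + 1)) (y (j + 1)) ^ 2) :=
    mul_nonneg (by linarith [neg_abs_le lam]) (by positivity)
  linarith

theorem crandallLiggettBound_le {μ c D h t s e T E : ℝ} (hμ : 0 ≤ μ) (hc : 0 ≤ c) (hD : 0 ≤ D)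
    (hh : 0 ≤ h) (ht : t ≤ T) (hs : s ≤ T) (he : 0 ≤ e) (heE : e ≤ E) :
    crandallLiggettBound μ c D h t s e ≤
      Real.exp (4 * μ * (T + T)) * (c + D * E) * (√((t - s) ^ 2 + h * (T + T)) + h) := by
  have hE : 0 ≤ E := he.trans heE
  calc crandallLiggettBound μ c D h t s e
      ≤ Real.exp (4 * μ * (T + T)) * (c * √((t - s) ^ 2 + h * (T + T)) + D * h * E) := by
        rw [crandallLiggettBound]
        gcongr
    _ ≤ Real.exp (4 * μ * (T + T)) * ((c + D * E) * (√((t - s) ^ 2 + h * (T + T)) + h)) := by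
        gcongr
        have hch : 0 ≤ c * h := by positivity
        have hDE : 0 ≤ D * E * √((t - s) ^ 2 + h * (T + T)) := by positivity
        linarith
    _ = _ := by ring

theorem IsEVIPotential.exists_energy_drop_le (hφ : IsEVIPotential lam C φ x₀) (T : ℝ) :
    ∃ h₀ > 0, ∃ E : ℝ, 0 ≤ E ∧ ∀ (P : TimePartition) (x : ℕ → X), IsDiscreteSolution φ P x₀ x →
      P.mesh ≤ ENNReal.ofReal h₀ → ∀ k, P.pt k ≤ T →
        (φ x₀).toReal - (φ (x k)).toReal ≤ E ∧ dist x₀ (x k) ^ 2 ≤ 2 * E * P.pt k := by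
  obtain ⟨A, B, hB, hlow⟩ := hφ.exists_quadratic_lower_bound
  obtain ⟨h₀, hh₀, M, hM⟩ :=
    exists_lower_bound_discreteSolution hφ.ne_bot hφ.mem_domain hB hlow T
  refine ⟨h₀, hh₀, |(φ x₀).toReal + M|, abs_nonneg _, fun P x hx hP k hk => ?_⟩
  have hdrop : (φ x₀).toReal - (φ (x k)).toReal ≤ |(φ x₀).toReal + M| :=
    (le_abs_self _).trans' (by linarith [hM P x hx hP k hk])
  exact ⟨hdrop, (hx.sq_dist_le hφ.ne_bot hφ.mem_domain k).trans
    (mul_le_mul_of_nonneg_right (by linarith) (P.pt_nonneg k))⟩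

theorem IsEVIPotential.exists_sq_dist_discreteSolution_le (hφ : IsEVIPotential lam C φ x₀)
    (T : ℝ) :
    ∃ h₀ > 0, ∃ G : ℝ, 0 ≤ G ∧ ∀ h ≤ h₀, ∀ (P Q : TimePartition) (x y : ℕ → X),
      IsDiscreteSolution φ P x₀ x → IsDiscreteSolution φ Q x₀ y →
      P.mesh ≤ ENNReal.ofReal h → Q.mesh ≤ ENNReal.ofReal h →
      ∀ i j, P.pt i ≤ T → Q.pt j ≤ T →
        dist (x i) (y j) ^ 2 ≤ G * (√((P.pt i - Q.pt j) ^ 2 + h * (T + T)) + h) := by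
  obtain ⟨h₁, hh₁, E, hE, henergy⟩ := hφ.exists_energy_drop_le T
  have hC := hφ.error_nonneg
  refine ⟨min h₁ (1 / (4 * |lam| + 1)), by positivity,
    Real.exp (4 * |lam| * (T + T)) * (2 * E + 2 * C * (2 * E)), by positivity,
    fun h hh P Q x y hx hy hP hQ i j hi hj => ?_⟩
  have hh0 : 0 ≤ h := (P.step_pos 0).le.trans (P.step_le_of_mesh_le hP 0)
  have hlamh : 4 * |lam| * h ≤ 1 := by
    have := (le_div_iff₀ (by positivity)).1 (hh.trans (min_le_right _ _))
    linarith
  have hh₁ : ENNReal.ofReal h ≤ ENNReal.ofReal h₁ :=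
    ENNReal.ofReal_le_ofReal (hh.trans (min_le_left _ _))
  have hPE := henergy P x hx (hP.trans hh₁)
  have hQE := henergy Q y hy (hQ.trans hh₁)
  have hCL := le_crandallLiggettBound (a := fun i j => dist (x i) (y j) ^ 2) (c := 2 * E)
    (abs_nonneg lam) (by positivity) (by positivity) hlamh (P.step_le_of_mesh_le hP)
    (Q.step_le_of_mesh_le hQ) (hx.toReal_antitone hφ.ne_bot hφ.mem_domain)
    (hy.toReal_antitone hφ.ne_bot hφ.mem_domain) (hφ.sq_dist_double_recursion hx hy)
    (fun k hk => by
      rw [hy.1, dist_comm]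
      exact (hPE k ((P.strictMono.monotone hk).trans hi)).2)
    (fun k hk => by
      rw [hx.1]
      exact (hQE k ((Q.strictMono.monotone hk).trans hj)).2) le_rfl le_rfl
  refine hCL.trans (crandallLiggettBound_le (abs_nonneg lam) (by positivity) (by positivity) hh0
    hi hj ?_ ?_) <;> simp only [hx.1, hy.1]
  · linarith [hx.toReal_le hφ.ne_bot hφ.mem_domain i, hy.toReal_le hφ.ne_bot hφ.mem_domain j]
  · linarith [(hPE i hi).1, (hQE j hj).1]

end DiscreteSolutions

/-! ### Convergence of the interpolations -/

section Interpolation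

namespace TimePartition

/-- The index of the first point of the partition not before `t`, at which the interpolation of a
discrete solution is evaluated at time `t`. -/
noncomputable def index (P : TimePartition) (t : ℝ) : ℕ := sInf {k : ℕ | t ≤ P.pt k}

theorem le_pt_index (P : TimePartition) (t : ℝ) : t ≤ P.pt (P.index t) :=
  Nat.sInf_mem (P.unbounded.eventually_ge_atTop t).exists

theorem pt_index_le (P : TimePartition) {h t : ℝ} (hP : P.mesh ≤ ENNReal.ofReal h) (ht : 0 ≤ t) :
    P.pt (P.index t) ≤ t + h := by
  have hh := P.step_le_of_mesh_le hP
  rcases hk : P.index t with _ | k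
  · linarith [P.pt_zero, P.step_pos 0, hh 0]
  · have hkt : ¬ t ≤ P.pt k :=
      Nat.notMem_of_lt_sInf ((Nat.lt_succ_self k).trans_eq hk.symm)
    linarith [not_le.1 hkt, hh k]

theorem index_pt (P : TimePartition) (k : ℕ) : P.index (P.pt k) = k :=
  le_antisymm (Nat.sInf_le (le_refl (P.pt k)))
    (le_csInf ⟨k, le_refl (P.pt k)⟩ fun _ hl => P.strictMono.le_iff_le.1 hl)

/-- The partition into intervals of constant length. -/
def uniform (h : ℝ) (hh : 0 < h) : TimePartition where
  pt k := k * h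
  pt_zero := by simp
  strictMono := fun _ _ hab => mul_lt_mul_of_pos_right (Nat.cast_lt.2 hab) hh
  unbounded := tendsto_natCast_atTop_atTop.atTop_mul_const hh

theorem mesh_uniform (h : ℝ) (hh : 0 < h) : (uniform h hh).mesh = ENNReal.ofReal h := by
  have hstep : ∀ k : ℕ, ((k + 1 : ℕ) : ℝ) * h - k * h = h := fun k => by push_cast; ring
  simp only [mesh, uniform, hstep, ciSup_const]

theorem exists_seq_mesh_lt {δ : ℝ} (hδ : 0 < δ) :
    ∃ P : ℕ → TimePartition, (∀ n, (P n).mesh < ENNReal.ofReal δ) ∧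
      Tendsto (fun n => (P n).mesh) atTop (𝓝 0) := by
  have hpos : ∀ n : ℕ, 0 < δ / (n + 2) := fun n => by positivity
  refine ⟨fun n => uniform _ (hpos n), fun n => ?_, ?_⟩
  · rw [mesh_uniform, ENNReal.ofReal_lt_ofReal_iff hδ]
    exact div_lt_self hδ (by linarith [n.cast_nonneg (α := ℝ)])
  · simp only [mesh_uniform]
    rw [← ENNReal.ofReal_zero]
    exact ENNReal.tendsto_ofReal (tendsto_const_nhds.div_atTop
      (tendsto_atTop_add_const_right _ _ tendsto_natCast_atTop_atTop))

end TimePartition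

variable {X : Type*} [MetricSpace X] {φ : X → EReal} {x₀ : X} {lam C : ℝ}

namespace IsEVIPotential

theorem exists_discreteSolution (hφ : IsEVIPotential lam C φ x₀) :
    ∃ δ : ℝ, 0 < δ ∧ ∀ P : TimePartition, P.mesh < ENNReal.ofReal δ →
      ∃ x : ℕ → X, IsDiscreteSolution φ P x₀ x := by
  obtain ⟨δ, hδ, hmin⟩ := hφ.exists_minimizer
  refine ⟨δ, hδ, fun P hP => ?_⟩
  have hstep : ∀ k, P.pt (k + 1) - P.pt k < δ := fun k =>
    (ENNReal.ofReal_lt_ofReal_iff hδ).1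
      ((le_iSup (fun k => ENNReal.ofReal (P.pt (k + 1) - P.pt k)) k).trans_lt hP)
  choose! F hF using hmin
  let x : ℕ → X := fun k => Nat.rec x₀ (fun k z => F z (P.pt (k + 1) - P.pt k)) k
  have hx : ∀ k, x k ∈ domain φ := by
    intro k
    induction k with
    | zero => exact hφ.mem_domain
    | succ k ih =>
      exact mem_domain_of_mem_minimizerSet (hF _ ih _ (P.step_pos k) (hstep k)) hφ.mem_domain
  exact ⟨x, rfl, fun k => hF _ (hx k) _ (P.step_pos k) (hstep k)⟩

theorem exists_sq_dist_interpolate_le (hφ : IsEVIPotential lam C φ x₀) (T : ℝ) :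
    ∃ h₀ > 0, ∃ G : ℝ, ∀ h ≤ h₀, ∀ (P Q : TimePartition) (x y : ℕ → X),
      IsDiscreteSolution φ P x₀ x → IsDiscreteSolution φ Q x₀ y →
      P.mesh ≤ ENNReal.ofReal h → Q.mesh ≤ ENNReal.ofReal h →
      ∀ t ∈ Icc 0 T, ∀ s ∈ Icc 0 T,
        dist (interpolate P x t) (interpolate Q y s) ^ 2
          ≤ G * (√((|t - s| + h) ^ 2 + h * ((T + 1) + (T + 1))) + h) := by
  obtain ⟨h₁, hh₁, G, hG0, hG⟩ := hφ.exists_sq_dist_discreteSolution_le (T + 1)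
  refine ⟨min h₁ 1, by positivity, G, fun h hh P Q x y hx hy hP hQ t ht s hs => ?_⟩
  have hh1 : h ≤ 1 := hh.trans (min_le_right _ _)
  have hi := P.pt_index_le hP ht.1
  have hj := Q.pt_index_le hQ hs.1
  have hgap : |P.pt (P.index t) - Q.pt (Q.index s)| ≤ |t - s| + h := by
    rw [abs_le]
    constructor <;>
      linarith [le_abs_self (t - s), neg_abs_le (t - s), P.le_pt_index t, Q.le_pt_index s]
  refine (hG h (hh.trans (min_le_left _ _)) P Q x y hx hy hP hQ _ _
    (by linarith [ht.2] : P.pt (P.index t) ≤ T + 1)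
    (by linarith [hs.2] : Q.pt (Q.index s) ≤ T + 1)).trans ?_
  rw [← sq_abs (P.pt _ - Q.pt _)]
  gcongr

theorem exists_dist_interpolate_lt (hφ : IsEVIPotential lam C φ x₀) (T : ℝ) {ε : ℝ}
    (hε : 0 < ε) :
    ∃ h > 0, ∀ (P Q : TimePartition) (x y : ℕ → X),
      IsDiscreteSolution φ P x₀ x → IsDiscreteSolution φ Q x₀ y →
      P.mesh ≤ ENNReal.ofReal h → Q.mesh ≤ ENNReal.ofReal h →
      ∀ t ∈ Icc 0 T, dist (interpolate P x t) (interpolate Q y t) < ε := by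
  obtain ⟨h₀, hh₀, G, hG⟩ := hφ.exists_sq_dist_interpolate_le T
  have hlim : Tendsto (fun h : ℝ => G * (√((|(0 : ℝ)| + h) ^ 2 + h * ((T + 1) + (T + 1))) + h))
      (𝓝[>] 0) (𝓝 0) :=
    (Continuous.tendsto' (by fun_prop) 0 _ (by simp)).mono_left nhdsWithin_le_nhds
  obtain ⟨h, hlt, hh⟩ := ((hlim.eventually_lt_const (by positivity : 0 < ε ^ 2)).and
    (Ioc_mem_nhdsGT hh₀)).exists
  refine ⟨h, hh.1, fun P Q x y hx hy hP hQ t ht => lt_of_pow_lt_pow_left₀ 2 hε.le ?_⟩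
  refine lt_of_le_of_lt ?_ hlt
  simpa only [sub_self] using hG h hh.2 P Q x y hx hy hP hQ t ht t ht

theorem exists_isGradientCurve [CompleteSpace X] (hφ : IsEVIPotential lam C φ x₀) :
    ∃ ξ : ℝ → X, IsGradientCurve φ x₀ ξ := by
  obtain ⟨δ, hδ, hsol⟩ := hφ.exists_discreteSolution
  obtain ⟨Q, hQδ, hQ⟩ := TimePartition.exists_seq_mesh_lt hδ
  choose z hz using fun n => hsol (Q n) (hQδ n)
  have hfine : ∀ {R : ℕ → TimePartition}, Tendsto (fun n => (R n).mesh) atTop (𝓝 0) →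
      ∀ {h : ℝ}, 0 < h → ∀ᶠ n in atTop, (R n).mesh ≤ ENNReal.ofReal h :=
    fun hR _ hh => hR.eventually_le_const (ENNReal.ofReal_pos.2 hh)
  have hlim : ∀ t : ℝ, 0 ≤ t → ∃ p, Tendsto (fun n => interpolate (Q n) (z n) t) atTop (𝓝 p) := by
    intro t ht
    refine cauchySeq_tendsto_of_complete (Metric.cauchySeq_iff.2 fun ε hε => ?_)
    obtain ⟨h, hh, hH⟩ := hφ.exists_dist_interpolate_lt t hε
    obtain ⟨N, hN⟩ := eventually_atTop.1 (hfine hQ hh)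
    exact ⟨N, fun m hm n hn => hH _ _ _ _ (hz m) (hz n) (hN m hm) (hN n hn) t ⟨ht, le_rfl⟩⟩
  have : Nonempty X := ⟨x₀⟩
  choose! ξ hξ using hlim
  refine ⟨ξ, ⟨δ, hδ, hsol⟩, fun P x hP hx T => Metric.tendstoUniformlyOn_iff.2 fun ε hε => ?_⟩
  obtain ⟨h, hh, hH⟩ := hφ.exists_dist_interpolate_lt T (half_pos hε)
  filter_upwards [hfine hP hh] with n hn t ht
  refine lt_of_le_of_lt ?_ (half_lt_self hε)
  refine le_of_tendsto ((hξ t ht.1).dist tendsto_const_nhds) ?_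
  filter_upwards [hfine hQ hh] with m hm
  exact (hH _ _ _ _ (hz m) (hx n) hm hn t ht).le

theorem isGradientCurve_gradientFlow [CompleteSpace X] (hφ : IsEVIPotential lam C φ x₀) :
    IsGradientCurve φ x₀ fun t => gradientFlow φ t x₀ := by
  have h := hφ.exists_isGradientCurve
  simp only [gradientFlow, dif_pos h]
  exact h.choose_spec

end IsEVIPotential

end Interpolation

/-! ### The evolution variational inequality in the limit -/

section GradientCurves

theorem ae_differentiableAt_of_antitoneOn_sub_mul {f : ℝ → ℝ}
    (hf : ∀ T : ℝ, ∃ L : ℝ, AntitoneOn (fun t => f t - L * t) (Icc 0 T)) :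
    ∀ᵐ t ∂(volume.restrict (Ioi (0 : ℝ))), DifferentiableAt ℝ f t := by
  have hae : ∀ᵐ t : ℝ, ∀ n : ℕ, t ∈ Ioo (0 : ℝ) n → DifferentiableAt ℝ f t := by
    refine ae_all_iff.2 fun n => ?_
    obtain ⟨L, hanti⟩ := hf n
    have hmono : MonotoneOn (fun t => -(f t - L * t)) (Ioo 0 (n : ℝ)) :=
      hanti.neg.mono Ioo_subset_Icc_self
    filter_upwards [hmono.ae_differentiableWithinAt_of_mem] with t ht hmem
    refine (((ht hmem).differentiableAt (Ioo_mem_nhds hmem.1 hmem.2)).neg.add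
      (differentiableAt_id.const_mul L)).congr_of_eventuallyEq (.of_forall fun s => ?_)
    simp
  rw [ae_restrict_iff' measurableSet_Ioi]
  filter_upwards [hae] with t ht ht0
  obtain ⟨n, hn⟩ := exists_nat_gt t
  exact ht n ⟨ht0, hn⟩

theorem limsup_coe_half_slope_eq {f : ℝ → ℝ} {v t : ℝ} (hf : HasDerivAt f v t) :
    limsup (fun ε : ℝ => (((f (t + ε) - f t) / (2 * ε) : ℝ) : EReal)) (𝓝[>] 0)
      = ((1 / 2 * v : ℝ) : EReal) := by
  refine Tendsto.limsup_eq ((continuous_coe_real_ereal.tendsto _).comp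
    ((hf.tendsto_slope_zero_right.const_mul (1 / 2)).congr fun ε => ?_))
  rw [smul_eq_mul, div_eq_mul_inv _ (2 * ε), mul_inv]
  ring

variable {X : Type*} [MetricSpace X] {φ : X → EReal} {x₀ y : X} {lam C : ℝ} {ξ : ℝ → X}

theorem eventually_eviRate_le (hbot : ∀ x, φ x ≠ ⊥) (hlsc : LowerSemicontinuous φ) {w : X}
    (hw : w ∈ domain φ) {L : ℝ} (hL : eviRate lam φ y w < L) :
    ∀ᶠ v in 𝓝 w, v ∈ domain φ → eviRate lam φ y v ≤ L := by
  obtain ⟨L', hwL', hL'L⟩ := exists_between hL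
  have hφ : (((φ w).toReal - (L - L') / 2 : ℝ) : EReal) < φ w := by
    conv_rhs => rw [← EReal.coe_toReal hw (hbot _)]
    exact_mod_cast sub_lt_self _ (by linarith)
  have hdist : Tendsto (fun v => 2 * ((φ y).toReal - (φ w).toReal) - lam * dist v y ^ 2) (𝓝 w)
      (𝓝 (eviRate lam φ y w)) := Continuous.tendsto' (by fun_prop) _ _ rfl
  filter_upwards [hlsc _ _ hφ, hdist.eventually_lt_const hwL'] with v hv hdv hvd
  rw [gt_iff_lt, ← EReal.coe_toReal hvd (hbot _), EReal.coe_lt_coe_iff] at hv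
  rw [eviRate]
  linarith

theorem IsEVIPotential.sq_dist_sub_le_of_eviRate_le (hφ : IsEVIPotential lam C φ x₀)
    (hy : y ∈ domain φ) {P : TimePartition} {x : ℕ → X} (hx : IsDiscreteSolution φ P x₀ x)
    {h L : ℝ} (hP : P.mesh ≤ ENNReal.ofReal h) {m n : ℕ} (hmn : m ≤ n)
    (hL : ∀ k, m < k → k ≤ n → eviRate lam φ y (x k) ≤ L) :
    dist (x n) y ^ 2 - dist (x m) y ^ 2
      ≤ (P.pt n - P.pt m) * L + 2 * C * h * ((φ (x m)).toReal - (φ (x n)).toReal) := by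
  induction n, hmn using Nat.le_induction with
  | base => simp
  | succ n hmn ih =>
    have hprev := ih fun k hmk hkn => hL k hmk (hkn.trans n.le_succ)
    have hτ := P.step_pos n
    have hstep := hφ.oneStepEVI _ (hx.mem_domain hφ.mem_domain n) _ hτ _ (hx.2 n) y hy
    have hrate := mul_le_mul_of_nonneg_left (hL (n + 1) (Nat.lt_succ_of_le hmn) le_rfl) hτ.le
    have hdecay : 0 ≤ 2 * ((φ (x n)).toReal - (φ (x (n + 1))).toReal) :=
      mul_nonneg zero_le_two
        (sub_nonneg.2 (hx.toReal_antitone hφ.ne_bot hφ.mem_domain (Nat.le_succ n)))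
    have herror := mul_le_mul_of_nonneg_left
      ((hx.sq_dist_step_le hφ.ne_bot hφ.mem_domain n).trans
        (mul_le_mul_of_nonneg_left (P.step_le_of_mesh_le hP n) hdecay)) hφ.error_nonneg
    linarith

/-- `ξ` is the locally uniform limit of interpolated discrete solutions `x n` from `x₀`, along
partitions `P n` of finite mesh tending to `0`. -/
structure IsApproximation (φ : X → EReal) (x₀ : X) (ξ : ℝ → X) (P : ℕ → TimePartition)
    (x : ℕ → ℕ → X) : Prop where
  sol : ∀ n, IsDiscreteSolution φ (P n) x₀ (x n)
  mesh_ne_top : ∀ n, (P n).mesh ≠ ⊤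
  tendsto_mesh : Tendsto (fun n => (P n).mesh) atTop (𝓝 0)
  tendstoUniformlyOn : ∀ T : ℝ,
    TendstoUniformlyOn (fun n t => interpolate (P n) (x n) t) ξ atTop (Icc 0 T)

theorem IsGradientCurve.exists_isApproximation (hξ : IsGradientCurve φ x₀ ξ) :
    ∃ P x, IsApproximation φ x₀ ξ P x := by
  obtain ⟨⟨δ, hδ, hsol⟩, hlim⟩ := hξ
  obtain ⟨P, hPδ, hP⟩ := TimePartition.exists_seq_mesh_lt hδ
  choose x hx using fun n => hsol (P n) (hPδ n)
  exact ⟨P, x, hx, fun n => ne_top_of_lt (hPδ n), hP, hlim P x hP hx⟩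

namespace IsApproximation

variable {P : ℕ → TimePartition} {x : ℕ → ℕ → X}

theorem mesh_le (ha : IsApproximation φ x₀ ξ P x) (n : ℕ) :
    (P n).mesh ≤ ENNReal.ofReal (P n).mesh.toReal :=
  (ENNReal.ofReal_toReal (ha.mesh_ne_top n)).ge

theorem tendsto_toReal_mesh (ha : IsApproximation φ x₀ ξ P x) :
    Tendsto (fun n => (P n).mesh.toReal) atTop (𝓝 0) :=
  (ENNReal.tendsto_toReal ENNReal.zero_ne_top).comp ha.tendsto_mesh

theorem tendsto_interpolate (ha : IsApproximation φ x₀ ξ P x) {t : ℝ} (ht : 0 ≤ t) :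
    Tendsto (fun n => interpolate (P n) (x n) t) atTop (𝓝 (ξ t)) :=
  (ha.tendstoUniformlyOn t).tendsto_at ⟨ht, le_rfl⟩

theorem tendsto_pt_index (ha : IsApproximation φ x₀ ξ P x) {t : ℝ} (ht : 0 ≤ t) :
    Tendsto (fun n => (P n).pt ((P n).index t)) atTop (𝓝 t) :=
  tendsto_of_tendsto_of_tendsto_of_le_of_le tendsto_const_nhds
    (by simpa using tendsto_const_nhds.add ha.tendsto_toReal_mesh)
    (fun n => (P n).le_pt_index t) (fun n => (P n).pt_index_le (ha.mesh_le n) ht)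

theorem mem_domain (ha : IsApproximation φ x₀ ξ P x) (hφ : IsEVIPotential lam C φ x₀) {t : ℝ}
    (ht : 0 ≤ t) : ξ t ∈ domain φ := by
  intro htop
  have hbig : ∀ᶠ w in 𝓝 (ξ t), φ x₀ < φ w :=
    hφ.lowerSemicontinuous _ _ (lt_of_lt_of_eq (lt_top_iff_ne_top.2 hφ.mem_domain) htop.symm)
  obtain ⟨n, (hn : φ x₀ < φ (x n ((P n).index t)))⟩ :=
    ((ha.tendsto_interpolate ht).eventually hbig).exists
  have hmem := (ha.sol n).mem_domain hφ.mem_domain ((P n).index t)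
  rw [← EReal.coe_toReal hmem (hφ.ne_bot _),
    ← EReal.coe_toReal hφ.mem_domain (hφ.ne_bot _), EReal.coe_lt_coe_iff] at hn
  exact hn.not_ge ((ha.sol n).toReal_le hφ.ne_bot hφ.mem_domain _)

theorem exists_lower_bound (ha : IsApproximation φ x₀ ξ P x) (hφ : IsEVIPotential lam C φ x₀)
    (T : ℝ) : ∃ M : ℝ, ∀ᶠ n in atTop, ∀ k, (P n).pt k ≤ T → -M ≤ (φ (x n k)).toReal := by
  obtain ⟨A, B, hB, hlow⟩ := hφ.exists_quadratic_lower_bound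
  obtain ⟨h, hh, M, hM⟩ := exists_lower_bound_discreteSolution hφ.ne_bot hφ.mem_domain hB hlow T
  refine ⟨M, ?_⟩
  filter_upwards [ha.tendsto_mesh.eventually_le_const (ENNReal.ofReal_pos.2 hh)] with n hn
  exact hM (P n) (x n) (ha.sol n) hn

theorem sq_dist_sub_le_of_eviRate_le (ha : IsApproximation φ x₀ ξ P x)
    (hφ : IsEVIPotential lam C φ x₀) (hy : y ∈ domain φ) {L s t η : ℝ} (hs : 0 ≤ s) (hst : s ≤ t)
    (hη : 0 < η)
    (hL : ∀ᶠ n in atTop, ∀ k, s ≤ (P n).pt k → (P n).pt k ≤ t + η →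
      eviRate lam φ y (x n k) ≤ L) :
    dist (ξ t) y ^ 2 - dist (ξ s) y ^ 2 ≤ (t - s) * L := by
  have ht := hs.trans hst
  obtain ⟨M, hM⟩ := ha.exists_lower_bound hφ (t + η)
  have hleft := (((ha.tendsto_interpolate ht).dist (tendsto_const_nhds (x := y))).pow 2).sub
    (((ha.tendsto_interpolate hs).dist (tendsto_const_nhds (x := y))).pow 2)
  have hright := (((ha.tendsto_pt_index ht).sub (ha.tendsto_pt_index hs)).mul_const L).add
    ((ha.tendsto_toReal_mesh.const_mul (2 * C)).mul_const ((φ x₀).toReal + M))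
  rw [mul_zero, zero_mul, add_zero] at hright
  refine le_of_tendsto_of_tendsto hleft hright ?_
  filter_upwards [hM, hL, ha.tendsto_toReal_mesh.eventually_le_const hη] with n hMn hLn hηn
  have hpt := (P n).pt_index_le (ha.mesh_le n) ht
  have hindex : (P n).index s ≤ (P n).index t := Nat.sInf_le (hst.trans ((P n).le_pt_index t))
  refine (hφ.sq_dist_sub_le_of_eviRate_le hy (ha.sol n) (ha.mesh_le n) hindex
    fun k hsk hkt => hLn k (((P n).le_pt_index s).trans ((P n).strictMono hsk).le) ?_).trans
      (add_le_add_right (mul_le_mul_of_nonneg_left ?_ ?_) _)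
  · linarith [(P n).strictMono.monotone hkt]
  · linarith [(ha.sol n).toReal_le hφ.ne_bot hφ.mem_domain ((P n).index s),
      hMn ((P n).index t) (by linarith)]
  · exact mul_nonneg (mul_nonneg zero_le_two hφ.error_nonneg) ENNReal.toReal_nonneg

theorem exists_sq_dist_le (ha : IsApproximation φ x₀ ξ P x) (hφ : IsEVIPotential lam C φ x₀)
    (T : ℝ) : ∃ G : ℝ, ∀ t ∈ Icc 0 T, ∀ s ∈ Icc 0 T, dist (ξ t) (ξ s) ^ 2 ≤ G * |t - s| := by
  obtain ⟨h₀, hh₀, G, hG⟩ := hφ.exists_sq_dist_interpolate_le T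
  refine ⟨G, fun t ht s hs => ?_⟩
  have hright : Tendsto
      (fun h : ℝ => G * (√((|t - s| + h) ^ 2 + h * ((T + 1) + (T + 1))) + h)) (𝓝 0)
      (𝓝 (G * |t - s|)) :=
    Continuous.tendsto' (by fun_prop) 0 _ (by simp [Real.sqrt_sq_eq_abs])
  refine le_of_tendsto_of_tendsto
    (((ha.tendsto_interpolate ht.1).dist (ha.tendsto_interpolate hs.1)).pow 2)
    (hright.comp ha.tendsto_toReal_mesh) ?_
  filter_upwards [ha.tendsto_toReal_mesh.eventually_le_const hh₀] with n hn
  exact hG _ hn _ _ _ _ (ha.sol n) (ha.sol n) (ha.mesh_le n) (ha.mesh_le n) t ht s hs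

theorem continuousWithinAt (ha : IsApproximation φ x₀ ξ P x) (hφ : IsEVIPotential lam C φ x₀)
    {t : ℝ} (ht : 0 ≤ t) : ContinuousWithinAt ξ (Ici t) t := by
  obtain ⟨G, hG⟩ := ha.exists_sq_dist_le hφ (t + 1)
  have hsqrt : Tendsto (fun s => √(G * |s - t|)) (𝓝[≥] t) (𝓝 0) :=
    (Continuous.tendsto' (by fun_prop) t _ (by simp)).mono_left nhdsWithin_le_nhds
  refine tendsto_iff_dist_tendsto_zero.2
    (squeeze_zero' (.of_forall fun _ => dist_nonneg) ?_ hsqrt)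
  filter_upwards [Icc_mem_nhdsGE (lt_add_one t)] with s hs
  exact Real.le_sqrt_of_sq_le (hG s ⟨ht.trans hs.1, hs.2⟩ t ⟨ht, by linarith⟩)

theorem exists_eventually_mem (ha : IsApproximation φ x₀ ξ P x) (hφ : IsEVIPotential lam C φ x₀)
    {t : ℝ} (ht : 0 ≤ t) {U : Set X} (hU : U ∈ 𝓝 (ξ t)) :
    ∃ κ > 0, ∀ᶠ n in atTop, ∀ k, t ≤ (P n).pt k → (P n).pt k ≤ t + κ → x n k ∈ U := by
  have hlim : Tendsto (fun p : ℕ × ℝ => interpolate (P p.1) (x p.1) p.2) (atTop ×ˢ 𝓝[≥] t)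
      (𝓝 (ξ t)) := by
    refine tendsto_comp_of_locally_uniform_limit_within (s := Ici t)
      (F := fun p : ℕ × ℝ => interpolate (P p.1) (x p.1)) (ha.continuousWithinAt hφ ht)
      tendsto_snd fun u hu => ⟨Icc t (t + 1), Icc_mem_nhdsGE (lt_add_one t), ?_⟩
    filter_upwards [tendsto_fst.eventually (ha.tendstoUniformlyOn (t + 1) u hu)] with p hp s hs
    exact hp s ⟨ht.trans hs.1, hs.2⟩
  obtain ⟨p, hp, q, hq, hpq⟩ := eventually_prod_iff.1 (hlim.eventually hU)
  obtain ⟨r, hr, hrq⟩ := (mem_nhdsGE_iff_exists_Icc_subset (a := t)).1 hq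
  refine ⟨r - t, sub_pos.2 hr, ?_⟩
  filter_upwards [hp] with n hn k htk hkr
  have hmem := hpq hn (hrq ⟨htk, by linarith⟩)
  rwa [show interpolate (P n) (x n) ((P n).pt k) = x n k from congrArg (x n) ((P n).index_pt k)]
    at hmem

theorem eventually_slope_le (ha : IsApproximation φ x₀ ξ P x) (hφ : IsEVIPotential lam C φ x₀)
    (hy : y ∈ domain φ) {t L : ℝ} (ht : 0 ≤ t) (hL : eviRate lam φ y (ξ t) < L) :
    ∀ᶠ ε in 𝓝[>] (0 : ℝ), (dist (ξ (t + ε)) y ^ 2 - dist (ξ t) y ^ 2) / (2 * ε) ≤ L / 2 := by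
  obtain ⟨κ, hκ, hnear⟩ := ha.exists_eventually_mem hφ ht
    (eventually_eviRate_le hφ.ne_bot hφ.lowerSemicontinuous (ha.mem_domain hφ ht) hL)
  filter_upwards [Ioo_mem_nhdsGT (half_pos hκ)] with ε hε
  have hdist := ha.sq_dist_sub_le_of_eviRate_le hφ hy ht (le_add_of_nonneg_right hε.1.le)
    (half_pos hκ) (L := L) (by
      filter_upwards [hnear] with n hn k htk hkt
      exact hn k htk (by linarith [hε.2]) ((ha.sol n).mem_domain hφ.mem_domain k))
  rw [div_le_iff₀ (mul_pos two_pos hε.1)]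
  linarith

theorem exists_antitoneOn (ha : IsApproximation φ x₀ ξ P x) (hφ : IsEVIPotential lam C φ x₀)
    (hy : y ∈ domain φ) (T : ℝ) :
    ∃ L : ℝ, AntitoneOn (fun t => dist (ξ t) y ^ 2 - L * t) (Icc 0 T) := by
  obtain ⟨M, hM⟩ := ha.exists_lower_bound hφ (T + 1)
  set R := 2 * dist x₀ y ^ 2 + 2 * (2 * ((φ x₀).toReal + M) * (T + 1))
  refine ⟨2 * ((φ y).toReal + M) + |lam| * R, fun s hs t ht hst => ?_⟩
  have hrate : ∀ᶠ n in atTop, ∀ k, s ≤ (P n).pt k → (P n).pt k ≤ t + 1 →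
      eviRate lam φ y (x n k) ≤ 2 * ((φ y).toReal + M) + |lam| * R := by
    filter_upwards [hM] with n hn k _ hk
    have hkT : (P n).pt k ≤ T + 1 := hk.trans (by linarith [ht.2])
    have hMk := hn k hkT
    have hx₀ : dist x₀ (x n k) ^ 2 ≤ 2 * ((φ x₀).toReal + M) * (T + 1) :=
      ((ha.sol n).sq_dist_le hφ.ne_bot hφ.mem_domain k).trans
        (mul_le_mul (by linarith) hkT ((P n).pt_nonneg k)
          (by linarith [(ha.sol n).toReal_le hφ.ne_bot hφ.mem_domain k]))
    have hR : dist (x n k) y ^ 2 ≤ R := by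
      have htri : dist (x n k) y ^ 2 ≤ (dist x₀ (x n k) + dist x₀ y) ^ 2 := by
        gcongr
        exact dist_triangle_left _ _ _
      linarith [sq_nonneg (dist x₀ (x n k) - dist x₀ y)]
    have hlam : -lam * dist (x n k) y ^ 2 ≤ |lam| * R :=
      mul_le_mul (neg_le_abs lam) hR (sq_nonneg _) (abs_nonneg _)
    rw [eviRate]
    linarith
  have hst := ha.sq_dist_sub_le_of_eviRate_le hφ hy hs.1 hst one_pos hrate
  simp only
  linarith

end IsApproximation

namespace IsEVIPotential

theorem mem_domain_of_isGradientCurve (hφ : IsEVIPotential lam C φ x₀)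
    (hξ : IsGradientCurve φ x₀ ξ) {t : ℝ} (ht : 0 ≤ t) : ξ t ∈ domain φ :=
  let ⟨_, _, ha⟩ := hξ.exists_isApproximation
  ha.mem_domain hφ ht

theorem limsup_evi (hφ : IsEVIPotential lam C φ x₀) (hξ : IsGradientCurve φ x₀ ξ)
    (hy : y ∈ domain φ) {t : ℝ} (ht : 0 ≤ t) :
    limsup (fun ε : ℝ =>
        (((dist (ξ (t + ε)) y ^ 2 - dist (ξ t) y ^ 2) / (2 * ε) : ℝ) : EReal)) (𝓝[>] 0)
      + ((lam / 2 * dist (ξ t) y ^ 2 : ℝ) : EReal) + φ (ξ t) ≤ φ y := by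
  obtain ⟨P, x, ha⟩ := hξ.exists_isApproximation
  have hlimsup : limsup (fun ε : ℝ =>
        (((dist (ξ (t + ε)) y ^ 2 - dist (ξ t) y ^ 2) / (2 * ε) : ℝ) : EReal)) (𝓝[>] 0)
      ≤ ((eviRate lam φ y (ξ t) / 2 : ℝ) : EReal) := by
    refine EReal.le_of_forall_lt_iff_le.1 fun L hL => limsup_le_of_le (by isBoundedDefault) ?_
    filter_upwards [ha.eventually_slope_le hφ hy ht (L := 2 * L)
      (by linarith [EReal.coe_lt_coe_iff.1 hL])] with ε hε
    exact_mod_cast hε.trans_eq (by ring)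
  refine (add_le_add_left (add_le_add_left hlimsup _) _).trans ?_
  rw [← EReal.coe_toReal (ha.mem_domain hφ ht) (hφ.ne_bot _),
    ← EReal.coe_toReal hy (hφ.ne_bot _), eviRate]
  norm_cast
  linarith

theorem ae_evi (hφ : IsEVIPotential lam C φ x₀) (hξ : IsGradientCurve φ x₀ ξ)
    (hy : y ∈ domain φ) :
    ∀ᵐ t ∂(volume.restrict (Ioi (0 : ℝ))),
      ∃ v : ℝ, HasDerivAt (fun s : ℝ => dist (ξ s) y ^ 2) v t ∧
        ((1 / 2 * v : ℝ) : EReal) + ((lam / 2 * dist (ξ t) y ^ 2 : ℝ) : EReal) + φ (ξ t)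
          ≤ φ y := by
  obtain ⟨P, x, ha⟩ := hξ.exists_isApproximation
  filter_upwards [ae_differentiableAt_of_antitoneOn_sub_mul (ha.exists_antitoneOn hφ hy),
    ae_restrict_mem measurableSet_Ioi] with t hdiff ht
  refine ⟨_, hdiff.hasDerivAt, ?_⟩
  rw [← limsup_coe_half_slope_eq hdiff.hasDerivAt]
  exact hφ.limsup_evi hξ hy (le_of_lt ht)

end IsEVIPotential

end GradientCurves

/-! ### Spherical trigonometry -/

section SphericalTriangles

open Real

section Sinc

variable {a b c p q r u w : ℝ}

theorem mul_sinc (u : ℝ) : u * sinc u = sin u := by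
  rcases eq_or_ne u 0 with rfl | hu
  · simp
  · rw [sinc_of_ne_zero hu, mul_div_cancel₀ _ hu]

theorem sinc_two_mul (u : ℝ) : sinc (2 * u) = sinc u * cos u := by
  rcases eq_or_ne u 0 with rfl | hu
  · simp
  · refine mul_left_cancel₀ (mul_ne_zero two_ne_zero hu) ?_
    rw [mul_sinc, sin_two_mul, ← mul_sinc u]
    ring

theorem sinc_antitoneOn : AntitoneOn sinc (Icc 0 π) := by
  intro u hu v hv huv
  rcases hu.1.eq_or_lt with rfl | hu0
  · exact sinc_zero ▸ sinc_le_one v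
  have hv0 := hu0.trans_le huv
  have hconc := strictConcaveOn_sin_Icc.concaveOn.2 ⟨le_rfl, pi_pos.le⟩ hv
    (sub_nonneg.2 ((div_le_one hv0).2 huv)) (by positivity) (sub_add_cancel 1 (u / v))
  simp only [smul_eq_mul, mul_zero, zero_add, sin_zero, div_mul_cancel₀ _ hv0.ne'] at hconc
  rwa [sinc_of_ne_zero hu0.ne', sinc_of_ne_zero hv0.ne', le_div_iff₀ hu0, div_mul_comm]

theorem cos_le_sinc (h0 : 0 ≤ u) (h1 : u ≤ π / 2) : cos u ≤ sinc u := by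
  rcases h0.eq_or_lt with rfl | h0
  · simp
  rcases h1.eq_or_lt with rfl | h1
  · rw [cos_pi_div_two, sinc_of_ne_zero (by positivity), sin_pi_div_two]
    positivity
  have hcos := cos_pos_of_mem_Ioo ⟨by linarith, h1⟩
  have htan := le_tan h0.le h1
  rw [tan_eq_sin_div_cos, le_div_iff₀ hcos] at htan
  rwa [sinc_of_ne_zero h0.ne', le_div_iff₀ h0, mul_comm]

theorem two_div_pi_le_sinc (h0 : 0 ≤ u) (h1 : u ≤ π / 2) : 2 / π ≤ sinc u := by
  have hπ := pi_pos
  refine le_trans (le_of_eq ?_)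
    (sinc_antitoneOn ⟨h0, by linarith⟩ ⟨by positivity, by linarith⟩ h1)
  rw [sinc_of_ne_zero (by positivity), sin_pi_div_two, one_div_div]

theorem sinc_pos (h0 : 0 ≤ u) (h1 : u ≤ π / 2) : 0 < sinc u :=
  lt_of_lt_of_le (by positivity) (two_div_pi_le_sinc h0 h1)

/-- The cosine is a convex function of the square of its argument; the left-hand side is the
tangent at `r ^ 2`. -/
theorem cos_add_sinc_mul_sq_sub_sq_le (hr : r ∈ Icc 0 π) (hw : w ∈ Icc 0 π) :
    cos r + sinc r / 2 * (r ^ 2 - w ^ 2) ≤ cos w := by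
  let g : ℝ → ℝ := fun u => cos u + sinc r / 2 * u ^ 2
  have hg (u : ℝ) : HasDerivAt g (u * (sinc r - sinc u)) u :=
    ((hasDerivAt_cos u).add ((hasDerivAt_pow 2 u).const_mul (sinc r / 2))).congr_deriv <| by
      rw [← mul_sinc u]
      push_cast
      ring
  have hcont : Continuous g := by fun_prop
  have hmin : g r ≤ g w := by
    rcases le_total w r with hwr | hrw
    · refine antitoneOn_of_hasDerivWithinAt_nonpos (convex_Icc 0 r) hcont.continuousOn
        (fun u _ => (hg u).hasDerivWithinAt) (fun u hu => ?_) ⟨hw.1, hwr⟩ ⟨hr.1, le_rfl⟩ hwr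
      rw [interior_Icc] at hu
      exact mul_nonpos_of_nonneg_of_nonpos hu.1.le
        (sub_nonpos.2 (sinc_antitoneOn ⟨hu.1.le, hu.2.le.trans hr.2⟩ hr hu.2.le))
    · refine monotoneOn_of_hasDerivWithinAt_nonneg (convex_Icc r π) hcont.continuousOn
        (fun u _ => (hg u).hasDerivWithinAt) (fun u hu => ?_) ⟨le_rfl, hr.2⟩ ⟨hrw, hw.2⟩ hrw
      rw [interior_Icc] at hu
      exact mul_nonneg (hr.1.trans hu.1.le)
        (sub_nonneg.2 (sinc_antitoneOn hr ⟨hr.1.trans hu.1.le, hu.2.le⟩ hu.1.le))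
  simp only [g] at hmin
  linarith

theorem hasDerivAt_mul_sinc_mul (b u : ℝ) :
    HasDerivAt (fun u => u * sinc (u * b)) (cos (u * b)) u := by
  rcases eq_or_ne b 0 with rfl | hb
  · simpa using hasDerivAt_id' u
  have heq : (fun u => u * sinc (u * b)) = fun u => sin (u * b) / b := by
    funext u
    rw [← mul_sinc (u * b)]
    field_simp
  rw [heq]
  exact (((hasDerivAt_mul_const b).sin).div_const b).congr_deriv (mul_div_cancel_right₀ _ hb)

theorem tendsto_sinc_sub_mul_sinc_div (b : ℝ) :
    Tendsto (fun s => (sinc b - (1 - s) * sinc ((1 - s) * b)) / s) (𝓝[>] 0) (𝓝 (cos b)) := by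
  have hd : HasDerivAt (fun s => (1 - s) * sinc ((1 - s) * b)) (-cos b) 0 := by
    simpa using (hasDerivAt_mul_sinc_mul b (1 - 0)).comp_const_sub 1 0
  have hslope := hd.tendsto_slope_zero_right.neg
  rw [neg_neg] at hslope
  refine hslope.congr fun s => ?_
  simp only [zero_add, sub_zero, one_mul, smul_eq_mul]
  ring

/-- For a spherical triangle with sides `a`, `b`, `c`, the left-hand side is the derivative of the
square of `a` when its end point moves along `b` with speed `b`; the right-hand side would have no
error term in the plane. -/
theorem sq_slope_le_of_sides (ha : a ∈ Icc 0 (π / 2)) (hb : b ∈ Icc 0 (π / 2))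
    (hc : c ∈ Icc 0 (π / 2)) (hcab : c ≤ a + b) :
    2 * (cos a * cos b - cos c) / (sinc a * sinc b) ≤ c ^ 2 - b ^ 2 + (π / 2) ^ 3 * a ^ 2 := by
  have hπ := pi_pos
  have hIcc {u : ℝ} (hu : u ∈ Icc 0 (π / 2)) : u ∈ Icc 0 π := ⟨hu.1, by linarith [hu.2]⟩
  have hsa := two_div_pi_le_sinc ha.1 ha.2
  have hsb : 0 < sinc b := sinc_pos hb.1 hb.2
  have hsa0 : 0 < sinc a := sinc_pos ha.1 ha.2
  have hcosb : 0 ≤ cos b := cos_nonneg_of_mem_Icc ⟨by linarith [hb.1], hb.2⟩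
  have htangent := cos_add_sinc_mul_sq_sub_sq_le (hIcc hb) (hIcc hc)
  have hnum : 2 * (cos a * cos b - cos c) ≤ sinc b * (c ^ 2 - b ^ 2) := by
    linarith [mul_le_of_le_one_left hcosb (cos_le_one a)]
  have hsinc : 1 - sinc a ≤ a ^ 2 / 2 := by
    linarith [cos_le_sinc ha.1 ha.2, one_sub_sq_div_two_le_cos (x := a)]
  have hsq : c ^ 2 - b ^ 2 ≤ π * a := by nlinarith [ha.1, hb.1, hb.2, hc.1, hc.2]
  have herr : (c ^ 2 - b ^ 2) * (1 - sinc a) ≤ (π / 2) ^ 3 * a ^ 2 * sinc a :=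
    calc (c ^ 2 - b ^ 2) * (1 - sinc a) ≤ π * a * (a ^ 2 / 2) :=
          (mul_le_mul_of_nonneg_right hsq (sub_nonneg.2 (sinc_le_one a))).trans
            (mul_le_mul_of_nonneg_left hsinc (mul_nonneg hπ.le ha.1))
      _ ≤ π * (π / 2) * (a ^ 2 / 2) := by
          have := ha.2
          gcongr
      _ = (π / 2) ^ 3 * a ^ 2 * (2 / π) := by field_simp
      _ ≤ (π / 2) ^ 3 * a ^ 2 * sinc a := by gcongr
  rw [div_le_iff₀ (mul_pos hsa0 hsb)]
  nlinarith [mul_le_mul_of_nonneg_left herr hsb.le]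

theorem mul_sq_le_sq_mean_sub_sq {D m : ℝ} (hp : p ∈ Icc 0 (π / 2)) (hq : q ∈ Icc 0 (π / 2))
    (hm : m ∈ Icc 0 D) (hD : D ≤ π / 2) (hb : b ∈ Icc 0 (π / 2))
    (h : cos p + cos q ≤ 2 * cos (b / 2) * cos m) :
    cos D / π ^ 2 * b ^ 2 ≤ (p ^ 2 + q ^ 2) / 2 - m ^ 2 := by
  have hπ := pi_pos
  have hIcc {u : ℝ} (hu : u ∈ Icc 0 (π / 2)) : u ∈ Icc 0 π := ⟨hu.1, by linarith [hu.2]⟩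
  have hm2 : m ∈ Icc 0 (π / 2) := ⟨hm.1, hm.2.trans hD⟩
  have htp := cos_add_sinc_mul_sq_sub_sq_le (hIcc hm2) (hIcc hp)
  have htq := cos_add_sinc_mul_sq_sub_sq_le (hIcc hm2) (hIcc hq)
  have hcosD : 0 ≤ cos D := cos_nonneg_of_mem_Icc ⟨by linarith [hm.1.trans hm.2], hD⟩
  have hcosm : cos D ≤ cos m := cos_le_cos_of_nonneg_of_le_pi hm.1 (by linarith) hm.2
  have hcosb : b ^ 2 / (2 * π ^ 2) ≤ 1 - cos (b / 2) := by
    have hcos := cos_le_one_sub_mul_cos_sq (x := b / 2)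
      (abs_le.2 ⟨by linarith [hb.1], by linarith [hb.2]⟩)
    have heq : b ^ 2 / (2 * π ^ 2) = 2 / π ^ 2 * (b / 2) ^ 2 := by ring
    linarith
  have hlow : cos D / π ^ 2 * b ^ 2 ≤ sinc m * ((p ^ 2 + q ^ 2) / 2 - m ^ 2) :=
    calc cos D / π ^ 2 * b ^ 2 = 2 * (cos D * (b ^ 2 / (2 * π ^ 2))) := by field_simp
      _ ≤ 2 * (cos m * (1 - cos (b / 2))) := by
          have := hcosD.trans hcosm
          gcongr
      _ ≤ sinc m * ((p ^ 2 + q ^ 2) / 2 - m ^ 2) := by linarith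
  have hpos : 0 < sinc m := sinc_pos hm2.1 hm2.2
  have hnonneg : 0 ≤ (p ^ 2 + q ^ 2) / 2 - m ^ 2 :=
    nonneg_of_mul_nonneg_right (le_trans (by positivity) hlow) hpos
  exact hlow.trans (mul_le_of_le_one_left hnonneg (sinc_le_one m))

end Sinc

section Sphere

variable {a b c a' b' c' d p q t : ℝ}

/-- The point of the unit sphere with the given coordinates. -/
def spherePoint (a b c : ℝ) (h : a ^ 2 + b ^ 2 + c ^ 2 = 1) : UnitSphere :=
  ⟨!₂[a, b, c], by simp [EuclideanSpace.norm_eq, Fin.sum_univ_three, h]⟩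

theorem cos_sphereDist_spherePoint (h : a ^ 2 + b ^ 2 + c ^ 2 = 1)
    (h' : a' ^ 2 + b' ^ 2 + c' ^ 2 = 1) :
    cos (sphereDist (spherePoint a b c h) (spherePoint a' b' c' h')) =
      a * a' + b * b' + c * c' := by
  rw [sphereDist, InnerProductGeometry.cos_angle, norm_eq_of_mem_sphere, norm_eq_of_mem_sphere]
  simp only [spherePoint, PiLp.inner_apply, Fin.sum_univ_three, RCLike.inner_apply, conj_trivial,
    mul_one, div_one, Matrix.cons_val]
  ring

theorem sphereDist_eq_of_cos_eq {x y : UnitSphere} (hd : d ∈ Icc 0 π)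
    (h : cos (sphereDist x y) = cos d) : sphereDist x y = d :=
  injOn_cos ⟨InnerProductGeometry.angle_nonneg _ _, InnerProductGeometry.angle_le_pi _ _⟩ hd h

/-- The great circle arc in the horizontal plane, run through with speed `b`. -/
noncomputable def sphereArc (b t : ℝ) : UnitSphere :=
  spherePoint (cos (t * b)) (sin (t * b)) 0 (by simp)

theorem sphereDist_sphereArc {s : ℝ} (hb : b ∈ Icc 0 π) (hs : s ∈ Icc (0 : ℝ) 1)
    (ht : t ∈ Icc (0 : ℝ) 1) : sphereDist (sphereArc b s) (sphereArc b t) = |s - t| * b := by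
  have hst : |s - t| ≤ 1 := abs_le.2 ⟨by linarith [hs.1, ht.2], by linarith [hs.2, ht.1]⟩
  refine sphereDist_eq_of_cos_eq
    ⟨mul_nonneg (abs_nonneg _) hb.1, (mul_le_of_le_one_left hb.1 hst).trans hb.2⟩ ?_
  rw [sphereArc, sphereArc, cos_sphereDist_spherePoint, ← abs_of_nonneg hb.1, ← abs_mul,
    abs_of_nonneg hb.1, cos_abs, sub_mul, cos_sub]
  ring

theorem sphereDist_sphereArc_zero_one (hb : b ∈ Icc 0 π) :
    sphereDist (sphereArc b 0) (sphereArc b 1) = b := by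
  simp [sphereDist_sphereArc hb]

theorem isMinimalGeodesic_sphereArc (hb : b ∈ Icc 0 π) :
    IsMinimalGeodesic sphereDist (sphereArc b) (sphereArc b 0) (sphereArc b 1) :=
  ⟨rfl, rfl, fun _ hs _ ht =>
    (sphereDist_sphereArc_zero_one hb).symm ▸ sphereDist_sphereArc hb hs ht⟩

/-- `p`, `q` are the distances of `(cos p, u, v)` from the end points of the horizontal arc of
length `b` that starts at `(1, 0, 0)`. -/
theorem exists_unit_vector_of_sides (hb : 0 < b) (hper : p + b + q < 2 * π)
    (hq : q ≤ p + b) (hp : p ≤ q + b) (hbpq : b ≤ p + q) :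
    ∃ u v : ℝ, cos p ^ 2 + u ^ 2 + v ^ 2 = 1 ∧ cos p * cos b + u * sin b = cos q := by
  have hsb : 0 < sin b := sin_pos_of_pos_of_lt_pi hb (by linarith)
  have hsum : cos (p + b) ≤ cos q := by
    have h1 := sin_nonneg_of_nonneg_of_le_pi (x := (p + b + q) / 2) (by linarith) (by linarith)
    have h2 := sin_nonneg_of_nonneg_of_le_pi (x := (p + b - q) / 2) (by linarith) (by linarith)
    linarith [cos_sub_cos (p + b) q, mul_nonneg h1 h2]
  have hdiff : cos q ≤ cos (p - b) := by
    have h1 := sin_nonneg_of_nonneg_of_le_pi (x := (q + (p - b)) / 2) (by linarith) (by linarith)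
    have h2 := sin_nonneg_of_nonneg_of_le_pi (x := (q - (p - b)) / 2) (by linarith) (by linarith)
    linarith [cos_sub_cos q (p - b), mul_nonneg h1 h2]
  rw [cos_add] at hsum
  rw [cos_sub] at hdiff
  obtain ⟨u, hu⟩ : ∃ u, u * sin b = cos q - cos p * cos b := ⟨_, div_mul_cancel₀ _ hsb.ne'⟩
  have husq : u ^ 2 ≤ sin p ^ 2 :=
    sq_le_sq' (le_of_mul_le_mul_right (by linarith) hsb) (le_of_mul_le_mul_right (by linarith) hsb)
  refine ⟨u, √(1 - cos p ^ 2 - u ^ 2), ?_, by linarith⟩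
  rw [sq_sqrt (by linarith [sin_sq_add_cos_sq p])]
  ring

end Sphere

end SphericalTriangles

/-! ### The squared distance in CAT(1)-spaces -/

section CAT1

open Real

variable {X : Type*} [MetricSpace X] {x y z : X} {γ : ℝ → X} {t : ℝ}

theorem IsCAT1.sin_mul_cos_dist_le (hX : IsCAT1 X) (hyz : y ≠ z)
    (hper : dist x y + dist y z + dist x z < 2 * π) (hγ : IsMinimalGeodesic dist γ y z)
    (ht : t ∈ Icc (0 : ℝ) 1) :
    sin ((1 - t) * dist y z) * cos (dist x y) + sin (t * dist y z) * cos (dist x z) ≤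
      sin (dist y z) * cos (dist x (γ t)) := by
  have hcomp := hX.2 x y z (by rwa [dist_comm z x]) γ hγ
  have htri₁ : dist x z ≤ dist x y + dist y z := dist_triangle _ _ _
  have htri₂ : dist x y ≤ dist x z + dist y z := dist_comm y z ▸ dist_triangle _ _ _
  have htri₃ : dist y z ≤ dist x y + dist x z := dist_comm x y ▸ dist_triangle _ _ _
  have hb : 0 < dist y z := dist_pos.2 hyz
  obtain ⟨u, v, hnorm, hu⟩ := exists_unit_vector_of_sides hb hper htri₁ htri₂ htri₃
  rw [dist_comm z x] at hcomp
  generalize dist y z = b at *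
  generalize dist x y = p at *
  generalize dist x z = q at *
  have hbπ : b ∈ Icc 0 π := ⟨hb.le, by linarith⟩
  have hle := hcomp (spherePoint _ _ _ hnorm) (sphereArc b 0) (sphereArc b 1)
    (sphereDist_eq_of_cos_eq ⟨by linarith, by linarith⟩ <| by
      rw [sphereArc, cos_sphereDist_spherePoint]
      simp)
    (sphereDist_sphereArc_zero_one hbπ)
    (sphereDist_eq_of_cos_eq ⟨by linarith, by linarith⟩ <| by
      rw [sphereArc, cos_sphereDist_spherePoint, one_mul]
      linarith)
    (sphereArc b) (isMinimalGeodesic_sphereArc hbπ) t ht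
  have hcos := cos_le_cos_of_nonneg_of_le_pi dist_nonneg (InnerProductGeometry.angle_le_pi _ _) hle
  rw [← sphereDist, sphereArc, cos_sphereDist_spherePoint, mul_zero, add_zero] at hcos
  calc sin ((1 - t) * b) * cos p + sin (t * b) * cos q
      = sin b * (cos p * cos (t * b) + u * sin (t * b)) := by
        rw [sub_mul, one_mul, sin_sub, ← hu]
        ring
    _ ≤ sin b * cos (dist x (γ t)) :=
        mul_le_mul_of_nonneg_left hcos (sin_nonneg_of_mem_Icc hbπ)

theorem IsCAT1.sinc_mul_cos_dist_le (hX : IsCAT1 X)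
    (hper : dist x y + dist y z + dist x z < 2 * π) (hγ : IsMinimalGeodesic dist γ y z)
    (ht : t ∈ Icc (0 : ℝ) 1) :
    (1 - t) * sinc ((1 - t) * dist y z) * cos (dist x y) +
      t * sinc (t * dist y z) * cos (dist x z) ≤ sinc (dist y z) * cos (dist x (γ t)) := by
  rcases eq_or_ne y z with rfl | hyz
  · have hγt : γ t = y := by
      have h := hγ.2.2 t ht 0 (left_mem_Icc.2 zero_le_one)
      rwa [hγ.1, dist_self, mul_zero, dist_eq_zero] at h
    rw [hγt, dist_self]
    simp only [mul_zero, sinc_zero]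
    linarith
  · have h := hX.sin_mul_cos_dist_le hyz hper hγ ht
    rw [← mul_sinc ((1 - t) * _), ← mul_sinc (t * _), ← mul_sinc (dist y z)] at h
    refine le_of_mul_le_mul_left ?_ (dist_pos.2 hyz)
    linarith

theorem IsCAT1.sq_dist_midpoint_le {D : ℝ} (hX : IsCAT1 X) (hD : D < π / 2)
    (hdiam : ∀ x y : X, dist x y ≤ D) (x : X) (hγ : IsMinimalGeodesic dist γ y z) :
    dist x (γ (1 / 2)) ^ 2 ≤
      (dist x y ^ 2 + dist x z ^ 2) / 2 - cos D / π ^ 2 * dist y z ^ 2 := by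
  have hdist (u v : X) : dist u v ∈ Icc 0 (π / 2) := ⟨dist_nonneg, (hdiam u v).trans hD.le⟩
  have hcmp := hX.sinc_mul_cos_dist_le (x := x) (t := 1 / 2)
    (by linarith [(hdist x y).2, (hdist y z).2, (hdist x z).2, pi_pos]) hγ
    ⟨by norm_num, by norm_num⟩
  have hdouble := sinc_two_mul (dist y z / 2)
  rw [mul_div_cancel₀ _ two_ne_zero] at hdouble
  have hpos : 0 < sinc (dist y z / 2) :=
    sinc_pos (by positivity) (by linarith [(hdist y z).1, (hdist y z).2])
  have hcos : cos (dist x y) + cos (dist x z) ≤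
      2 * cos (dist y z / 2) * cos (dist x (γ (1 / 2))) := by
    refine le_of_mul_le_mul_left ?_ hpos
    rw [hdouble, show (1 - 1 / 2) * dist y z = dist y z / 2 by ring,
      show 1 / 2 * dist y z = dist y z / 2 by ring] at hcmp
    linarith
  linarith [mul_sq_le_sq_mean_sub_sq (hdist x y) (hdist x z) ⟨dist_nonneg, hdiam x (γ (1 / 2))⟩
    hD.le (hdist y z) hcos]

theorem IsMinimalGeodesic.tendsto_dist (hγ : IsMinimalGeodesic dist γ y z) (x : X) :
    Tendsto (fun s => dist x (γ s)) (𝓝[>] 0) (𝓝 (dist x y)) := by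
  refine tendsto_const_nhds.dist (tendsto_iff_dist_tendsto_zero.2 ?_)
  have hlim : Tendsto (fun s : ℝ => s * dist y z) (𝓝[>] 0) (𝓝 0) :=
    (Continuous.tendsto' (by fun_prop) 0 0 (by simp)).mono_left nhdsWithin_le_nhds
  refine hlim.congr' ?_
  filter_upwards [Ioo_mem_nhdsGT (zero_lt_one' ℝ)] with s hs
  have h := hγ.2.2 s ⟨hs.1.le, hs.2.le⟩ 0 (left_mem_Icc.2 zero_le_one)
  rw [hγ.1, sub_zero, abs_of_pos hs.1] at h
  exact h.symm

/-- The bound tends, as `s → 0`, to the first variation on the sphere. -/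
theorem IsCAT1.sq_dist_slope_le (hX : IsCAT1 X) (hdiam : ∀ x y : X, dist x y < π / 2) (x : X)
    (hγ : IsMinimalGeodesic dist γ y z) {s : ℝ} (hs : s ∈ Ioc (0 : ℝ) 1) :
    (dist x (γ s) ^ 2 - dist x y ^ 2) / s ≤
      2 * (cos (dist x y) * ((sinc (dist y z) - (1 - s) * sinc ((1 - s) * dist y z)) / s) -
        sinc (s * dist y z) * cos (dist x z)) / (sinc (dist x (γ s)) * sinc (dist y z)) := by
  have hπ := pi_pos
  have hsinc (u v : X) : 0 < sinc (dist u v) := sinc_pos dist_nonneg (hdiam u v).le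
  have hIcc (u v : X) : dist u v ∈ Icc 0 π := ⟨dist_nonneg, by linarith [hdiam u v]⟩
  have htangent := cos_add_sinc_mul_sq_sub_sq_le (hIcc x (γ s)) (hIcc x y)
  have hcmp := hX.sinc_mul_cos_dist_le (x := x)
    (by linarith [hdiam x y, hdiam y z, hdiam x z]) hγ ⟨hs.1.le, hs.2⟩
  rw [div_le_div_iff₀ hs.1 (mul_pos (hsinc _ _) (hsinc _ _))]
  calc (dist x (γ s) ^ 2 - dist x y ^ 2) * (sinc (dist x (γ s)) * sinc (dist y z))
      ≤ 2 * (cos (dist x y) - cos (dist x (γ s))) * sinc (dist y z) := by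
        rw [← mul_assoc]
        exact mul_le_mul_of_nonneg_right (by linarith) (hsinc y z).le
    _ ≤ 2 * (cos (dist x y) * (sinc (dist y z) - (1 - s) * sinc ((1 - s) * dist y z)) -
          s * sinc (s * dist y z) * cos (dist x z)) := by linarith
    _ = _ := by
        field_simp [hs.1.ne']

theorem IsCAT1.eventually_sq_dist_slope_le (hX : IsCAT1 X)
    (hdiam : ∀ x y : X, dist x y < π / 2) (x : X) (hγ : IsMinimalGeodesic dist γ y z) {v : ℝ}
    (hv : dist x z ^ 2 - dist y z ^ 2 + (π / 2) ^ 3 * dist x y ^ 2 < v) :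
    ∀ᶠ s in 𝓝[>] (0 : ℝ), (dist x (γ s) ^ 2 - dist x (γ 0) ^ 2) / s ≤ v := by
  have hdist (u v : X) : dist u v ∈ Icc 0 (π / 2) := ⟨dist_nonneg, (hdiam u v).le⟩
  have hsinc (u v : X) : sinc (dist u v) ≠ 0 := (sinc_pos dist_nonneg (hdiam u v).le).ne'
  have hsinc_arc : Tendsto (fun s => sinc (s * dist y z)) (𝓝[>] 0) (𝓝 1) :=
    (Continuous.tendsto' (by fun_prop) 0 _ (by simp)).mono_left nhdsWithin_le_nhds
  have hlim := ((((tendsto_sinc_sub_mul_sinc_div (dist y z)).const_mul (cos (dist x y))).sub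
    (hsinc_arc.mul_const (cos (dist x z)))).const_mul 2).div
    (((continuous_sinc.tendsto _).comp (hγ.tendsto_dist x)).mul_const (sinc (dist y z)))
    (mul_ne_zero (hsinc x y) (hsinc y z))
  rw [one_mul] at hlim
  have hbound := sq_slope_le_of_sides (hdist x y) (hdist y z) (hdist x z) (dist_triangle x y z)
  filter_upwards [hlim.eventually_lt_const (hbound.trans_lt hv), Ioo_mem_nhdsGT (zero_lt_one' ℝ)]
    with s hlt hs
  rw [hγ.1]
  exact (hX.sq_dist_slope_le hdiam x hγ ⟨hs.1, hs.2.le⟩).trans hlt.le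

theorem IsCAT1.oneStepEVI {lam : ℝ} {φ : X → EReal} (hX : IsCAT1 X)
    (hdiam : ∀ x y : X, dist x y < π / 2) (hbot : ∀ x, φ x ≠ ⊥) (hconv : IsLambdaConvex lam φ) :
    OneStepEVI lam ((π / 2) ^ 3) φ := by
  intro x _ τ hτ z hz y hy
  obtain ⟨γ, hγ, hconvγ⟩ := hconv z (mem_domain_of_mem_minimizerSet hz hy) y hy
  have hslope {v : ℝ} := hX.eventually_sq_dist_slope_le hdiam x hγ (v := v)
  obtain ⟨rfl, rfl, -⟩ := hγ
  have hmin := neg_mul_eviRate_le_of_mem_minimizerSet hbot hτ hz hy hconvγ fun _ hv => hslope hv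
  linarith

end CAT1

/-! ### Existence of minimizers of λ-convex functionals -/

section Minimizers

variable {X : Type*} [MetricSpace X] {φ : X → EReal} {lam : ℝ}

/-- The value at a midpoint cannot undercut the infimum. -/
theorem cauchySeq_of_midpoint_convex {f : X → ℝ} {s : Set X} {I k : ℝ} (hk : 0 < k)
    (hI : ∀ z ∈ s, I ≤ f z)
    (hmid : ∀ y ∈ s, ∀ z ∈ s, ∃ m ∈ s, f m ≤ (f y + f z) / 2 - k * dist y z ^ 2)
    {z : ℕ → X} (hz : ∀ n, z n ∈ s) (hzI : ∀ n : ℕ, f (z n) < I + 1 / ((n : ℝ) + 1)) :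
    CauchySeq z := by
  refine cauchySeq_of_le_tendsto_0 (fun n : ℕ => √(1 / ((n : ℝ) + 1) / k)) (fun n m N hn hm => ?_)
    (by simpa using (tendsto_one_div_add_atTop_nhds_zero_nat.div_const k).sqrt)
  obtain ⟨w, hw, hle⟩ := hmid _ (hz n) _ (hz m)
  have hn' : 1 / ((n : ℝ) + 1) ≤ 1 / ((N : ℝ) + 1) := by gcongr
  have hm' : 1 / ((m : ℝ) + 1) ≤ 1 / ((N : ℝ) + 1) := by gcongr
  refine Real.le_sqrt_of_sq_le ((le_div_iff₀ hk).2 ?_)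
  linarith [hI w hw, hzI n, hzI m]

theorem exists_forall_le_of_midpoint_convex [CompleteSpace X] {k A : ℝ} (hk : 0 < k)
    (hlsc : LowerSemicontinuous φ) (hne : (domain φ).Nonempty) (hA : ∀ z, (A : EReal) ≤ φ z)
    (hmid : ∀ y ∈ domain φ, ∀ z ∈ domain φ, ∃ m ∈ domain φ,
      (φ m).toReal ≤ ((φ y).toReal + (φ z).toReal) / 2 - k * dist y z ^ 2) :
    ∃ p, ∀ y, φ p ≤ φ y := by
  have hcoe {z : X} (hz : z ∈ domain φ) : ((φ z).toReal : EReal) = φ z :=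
    EReal.coe_toReal hz (ne_bot_of_le_ne_bot (EReal.coe_ne_bot A) (hA z))
  obtain ⟨I, hI⟩ : ∃ I : ℝ, (I : EReal) = ⨅ z, φ z := by
    obtain ⟨y, hy⟩ := hne
    exact ⟨_, EReal.coe_toReal (ne_top_of_le_ne_top hy (iInf_le _ y))
      (ne_bot_of_le_ne_bot (EReal.coe_ne_bot A) (le_iInf hA))⟩
  have hIle {z : X} (hz : z ∈ domain φ) : I ≤ (φ z).toReal := by
    rw [← EReal.coe_le_coe_iff, hI, hcoe hz]
    exact iInf_le _ z
  have hseq (n : ℕ) : ∃ z ∈ domain φ, (φ z).toReal < I + 1 / ((n : ℝ) + 1) := by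
    have hlt : ⨅ z, φ z < ((I + 1 / ((n : ℝ) + 1) : ℝ) : EReal) := by
      rw [← hI, EReal.coe_lt_coe_iff]
      exact lt_add_of_pos_right I (by positivity)
    obtain ⟨z, hz⟩ := iInf_lt_iff.1 hlt
    have hzd : z ∈ domain φ := hz.ne_top
    exact ⟨z, hzd, by rwa [← EReal.coe_lt_coe_iff, hcoe hzd]⟩
  choose z hz hzI using hseq
  obtain ⟨p, hp⟩ := cauchySeq_tendsto_of_complete
    (cauchySeq_of_midpoint_convex hk (fun _ => hIle) hmid hz hzI)
  refine ⟨p, fun y => le_trans (EReal.ge_of_forall_gt_iff_ge.1 fun c hc => ?_)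
    (hI.trans_le (iInf_le _ y))⟩
  have hlim : Tendsto (fun n : ℕ => I + 1 / ((n : ℝ) + 1)) atTop (𝓝 I) := by
    simpa using tendsto_one_div_add_atTop_nhds_zero_nat.const_add I
  refine EReal.coe_le_coe_iff.2 (ge_of_tendsto hlim ?_)
  filter_upwards [hp.eventually (hlsc p c hc)] with n hn
  rw [gt_iff_lt, ← hcoe (hz n), EReal.coe_lt_coe_iff] at hn
  exact (hn.trans (hzI n)).le

theorem IsLambdaConvex.exists_lower_bound {D : ℝ} {x₀ : X} (hbot : ∀ x, φ x ≠ ⊥)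
    (hlsc : LowerSemicontinuousAt φ x₀) (hconv : IsLambdaConvex lam φ)
    (hdiam : ∀ y, dist x₀ y ≤ D) (hx₀ : x₀ ∈ domain φ) :
    ∃ A : ℝ, ∀ z ∈ domain φ, -A ≤ (φ z).toReal := by
  have hlt : (((φ x₀).toReal - 1 : ℝ) : EReal) < φ x₀ := by
    conv_rhs => rw [← EReal.coe_toReal hx₀ (hbot _)]
    exact_mod_cast sub_lt_self _ one_pos
  obtain ⟨r, hr, hball⟩ := Metric.eventually_nhds_iff.1 (hlsc _ hlt)
  obtain ⟨t, htD, ht0, ht1⟩ : ∃ t : ℝ, t * D < r ∧ 0 < t ∧ t < 1 := by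
    have hlim : Tendsto (fun t : ℝ => t * D) (𝓝[>] 0) (𝓝 0) :=
      (Continuous.tendsto' (by fun_prop) 0 0 (zero_mul D)).mono_left nhdsWithin_le_nhds
    exact ((hlim.eventually_lt_const hr).and (Ioo_mem_nhdsGT zero_lt_one)).exists
  refine ⟨-(φ x₀).toReal + 1 / t + |lam| / 2 * D ^ 2, fun z hz => ?_⟩
  obtain ⟨γ, ⟨rfl, rfl, hγ⟩, hconvγ⟩ := hconv x₀ hx₀ z hz
  have ht : t ∈ Icc (0 : ℝ) 1 := ⟨ht0.le, ht1.le⟩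
  have hdist : dist (γ t) (γ 0) < r := by
    rw [hγ t ht 0 (left_mem_Icc.2 zero_le_one), sub_zero, abs_of_pos ht0]
    exact (mul_le_mul_of_nonneg_left (hdiam _) ht0.le).trans_lt htD
  have hnear : (φ (γ 0)).toReal - 1 < (φ (γ t)).toReal := by
    have h : (((φ (γ 0)).toReal - 1 : ℝ) : EReal) < φ (γ t) := hball hdist
    rw [← EReal.coe_toReal (hconvγ.mem_domain hbot hx₀ hz ht) (hbot (γ t))] at h
    exact_mod_cast h
  have hsq : (1 - t) * dist (γ 0) (γ 1) ^ 2 ≤ D ^ 2 :=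
    (mul_le_of_le_one_left (sq_nonneg _) (by linarith)).trans
      (pow_le_pow_left₀ dist_nonneg (hdiam _) 2)
  have hlam : -lam * ((1 - t) * dist (γ 0) (γ 1) ^ 2) ≤ |lam| * D ^ 2 :=
    mul_le_mul (neg_le_abs lam) hsq (mul_nonneg (by linarith) (sq_nonneg _)) (abs_nonneg _)
  have hle := hconvγ.toReal_le hbot hx₀ hz ht
  refine le_of_mul_le_mul_left ?_ ht0
  linarith [mul_le_mul_of_nonneg_left hlam ht0.le, mul_one_div_cancel ht0.ne']

/-- The uniform convexity of the squared distance, weighted by `1 / (2 * τ)`, outweighs the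
possible lack of convexity of `φ`. -/
theorem ConvexAlong.add_sq_dist_half_le {γ : ℝ → X} {k τ : ℝ} {x : X} (hγ : ConvexAlong lam φ γ)
    (hbot : ∀ x, φ x ≠ ⊥) (h0 : γ 0 ∈ domain φ) (h1 : γ 1 ∈ domain φ)
    (hmid : dist x (γ (1 / 2)) ^ 2 ≤
      (dist x (γ 0) ^ 2 + dist x (γ 1) ^ 2) / 2 - k * dist (γ 0) (γ 1) ^ 2)
    (hτ : 0 < τ) (hτk : 2 * τ * (1 + |lam|) ≤ k) :
    (φ (γ (1 / 2))).toReal + dist x (γ (1 / 2)) ^ 2 / (2 * τ) ≤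
      ((φ (γ 0)).toReal + dist x (γ 0) ^ 2 / (2 * τ)
        + ((φ (γ 1)).toReal + dist x (γ 1) ^ 2 / (2 * τ))) / 2 - 1 / 2 * dist (γ 0) (γ 1) ^ 2 := by
  have hφ := hγ.toReal_le hbot h0 h1 (t := 1 / 2) ⟨by norm_num, by norm_num⟩
  have hdist : dist x (γ (1 / 2)) ^ 2 / (2 * τ) ≤
      (dist x (γ 0) ^ 2 / (2 * τ) + dist x (γ 1) ^ 2 / (2 * τ)) / 2
        - (1 + |lam|) * dist (γ 0) (γ 1) ^ 2 := by
    rw [div_le_iff₀ (by positivity)]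
    calc dist x (γ (1 / 2)) ^ 2
        ≤ (dist x (γ 0) ^ 2 + dist x (γ 1) ^ 2) / 2
            - 2 * τ * (1 + |lam|) * dist (γ 0) (γ 1) ^ 2 := hmid.trans (by gcongr)
      _ = _ := by field_simp
  have hlam : 0 ≤ (1 / 2 + |lam| + lam / 8) * dist (γ 0) (γ 1) ^ 2 :=
    mul_nonneg (by linarith [neg_abs_le lam, abs_nonneg lam]) (sq_nonneg _)
  linarith

theorem IsLambdaConvex.nonempty_minimizerSet [CompleteSpace X] {k A τ : ℝ}
    (hbot : ∀ x, φ x ≠ ⊥) (hlsc : LowerSemicontinuous φ) (hconv : IsLambdaConvex lam φ)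
    (hne : (domain φ).Nonempty) (hA : ∀ z ∈ domain φ, -A ≤ (φ z).toReal) (x : X)
    (hmid : ∀ (y z : X) (γ : ℝ → X), IsMinimalGeodesic dist γ y z →
      dist x (γ (1 / 2)) ^ 2 ≤ (dist x y ^ 2 + dist x z ^ 2) / 2 - k * dist y z ^ 2)
    (hτ : 0 < τ) (hτk : 2 * τ * (1 + |lam|) ≤ k) : (minimizerSet φ τ x).Nonempty := by
  let ψ : X → EReal := fun z => φ z + ((dist x z ^ 2 / (2 * τ) : ℝ) : EReal)
  have hdom : domain ψ = domain φ := by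
    ext z
    refine ⟨fun h hz => h (by simp [ψ, hz]), fun h => EReal.add_ne_top h (EReal.coe_ne_top _)⟩
  have hψ {z : X} (hz : z ∈ domain φ) :
      (ψ z).toReal = (φ z).toReal + dist x z ^ 2 / (2 * τ) :=
    EReal.toReal_add hz (hbot z) (EReal.coe_ne_top _) (EReal.coe_ne_bot _)
  have hψlsc : LowerSemicontinuous ψ := by
    refine hlsc.add' (continuous_coe_real_ereal.comp (by fun_prop)).lowerSemicontinuous fun z => ?_
    exact EReal.continuousAt_add (.inr (EReal.coe_ne_bot _)) (.inr (EReal.coe_ne_top _))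
  have hψA (z : X) : ((-A : ℝ) : EReal) ≤ ψ z := by
    by_cases hz : z ∈ domain φ
    · refine le_add_of_le_of_nonneg ?_ (EReal.coe_nonneg.2 (by positivity))
      rw [← EReal.coe_toReal hz (hbot z)]
      exact EReal.coe_le_coe (hA z hz)
    · exact le_top.trans_eq (not_not.1 (hdom ▸ hz)).symm
  have hψmid : ∀ y ∈ domain ψ, ∀ z ∈ domain ψ, ∃ m ∈ domain ψ,
      (ψ m).toReal ≤ ((ψ y).toReal + (ψ z).toReal) / 2 - 1 / 2 * dist y z ^ 2 := by
    rw [hdom]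
    intro y hy z hz
    obtain ⟨γ, hγ, hconvγ⟩ := hconv y hy z hz
    have hmidγ := hmid y z γ hγ
    obtain ⟨rfl, rfl, -⟩ := hγ
    have hm := hconvγ.mem_domain hbot hy hz (t := 1 / 2) ⟨by norm_num, by norm_num⟩
    refine ⟨γ (1 / 2), hm, ?_⟩
    rw [hψ hy, hψ hz, hψ hm]
    exact hconvγ.add_sq_dist_half_le hbot hy hz hmidγ hτ hτk
  obtain ⟨p, hp⟩ :=
    exists_forall_le_of_midpoint_convex one_half_pos hψlsc (hdom ▸ hne) hψA hψmid
  exact ⟨p, le_antisymm (le_iInf hp) (iInf_le _ p)⟩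

end Minimizers

/-! ### The two cases -/

section Cases

variable {X : Type*} [MetricSpace X] {φ : X → EReal} {lam : ℝ} {x₀ : X}

theorem IsCAT1.exists_isEVIPotential [CompleteSpace X] (hX : IsCAT1 X)
    (hdiam : Metric.ediam (univ : Set X) < ENNReal.ofReal (Real.pi / 2))
    (hbot : ∀ x, φ x ≠ ⊥) (hlsc : LowerSemicontinuous φ) (hconv : IsLambdaConvex lam φ)
    (hx₀ : x₀ ∈ domain φ) : ∃ C, IsEVIPotential lam C φ x₀ := by
  have hfin : Metric.ediam (univ : Set X) ≠ ⊤ := ne_top_of_lt hdiam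
  obtain ⟨D, hDpi, hD⟩ : ∃ D : ℝ, D < Real.pi / 2 ∧ ∀ x y : X, dist x y ≤ D := by
    refine ⟨_, (ENNReal.lt_ofReal_iff_toReal_lt hfin).1 hdiam, fun x y => ?_⟩
    rw [dist_edist]
    exact ENNReal.toReal_mono hfin (Metric.edist_le_ediam_of_mem (mem_univ x) (mem_univ y))
  obtain ⟨A, hA⟩ := hconv.exists_lower_bound hbot (hlsc x₀) (hD x₀) hx₀
  have hcos : 0 < Real.cos D := Real.cos_pos_of_mem_Ioo
    ⟨by linarith [Real.pi_pos, dist_self x₀, hD x₀ x₀], hDpi⟩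
  refine ⟨_, hbot, hlsc, hx₀, by positivity,
    hX.oneStepEVI (fun x y => (hD x y).trans_lt hDpi) hbot hconv,
    ⟨A, 0, le_rfl, fun z hz => by simpa only [zero_mul, sub_zero] using hA z hz⟩,
    Real.cos D / Real.pi ^ 2 / (2 * (1 + |lam|)), by positivity, fun x _ τ hτ hτδ => ?_⟩
  rw [lt_div_iff₀ (by positivity)] at hτδ
  exact hconv.nonempty_minimizerSet hbot hlsc ⟨x₀, hx₀⟩ hA x
    (fun _ _ _ hγ => hX.sq_dist_midpoint_le hDpi hD x hγ) hτ (by linarith)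

theorem IsCoercive.exists_quadratic_lower_bound (hφ : IsCoercive φ) (hbot : ∀ x, φ x ≠ ⊥)
    (x₀ : X) : ∃ A B : ℝ, 0 ≤ B ∧ ∀ z ∈ domain φ, -A - B * dist x₀ z ^ 2 ≤ (φ z).toReal := by
  obtain ⟨τ, hτ, hmin⟩ := hφ
  obtain ⟨c, -, hlt⟩ := EReal.lt_iff_exists_real_btwn.1
    (hmin x₀ (τ / 2) (half_pos hτ) (half_lt_self hτ)).1
  refine ⟨-c, 1 / (2 * (τ / 2)), by positivity, fun z hz => ?_⟩
  have hle : (c : EReal) ≤ φ z + ((dist x₀ z ^ 2 / (2 * (τ / 2)) : ℝ) : EReal) :=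
    hlt.le.trans (iInf_le _ z)
  rw [← EReal.coe_toReal hz (hbot z), ← EReal.coe_add, EReal.coe_le_coe_iff] at hle
  rw [one_div_mul_eq_div]
  linarith

theorem IsAdmissibleFamily.isEVIPotential {K : ℝ} {Γ : Set (ℝ → X)}
    (hΓ : IsAdmissibleFamily lam K φ Γ) (hφ : IsCoercive φ) (hbot : ∀ x, φ x ≠ ⊥)
    (hlsc : LowerSemicontinuous φ) (hx₀ : x₀ ∈ domain φ) :
    IsEVIPotential lam (|K| / 2) φ x₀ := by
  refine ⟨hbot, hlsc, hx₀, by positivity, hΓ.oneStepEVI hbot,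
    hφ.exists_quadratic_lower_bound hbot x₀, ?_⟩
  obtain ⟨τ, hτ, hmin⟩ := hφ
  exact ⟨τ, hτ, fun x _ σ hσ hστ => (hmin x σ hσ hστ).2⟩

end Cases

end EVIFlow

theorem theorem4p5 {X : Type*} [MetricSpace X] [CompleteSpace X] (lam : ℝ) (φ : X → EReal)
    (hφ_bot : ∀ x, φ x ≠ ⊥) (hφ_lsc : LowerSemicontinuous φ)
    (hcase :
      (EVIFlow.IsCAT1 X ∧ Metric.ediam (Set.univ : Set X) < ENNReal.ofReal (Real.pi / 2) ∧
        EVIFlow.IsLambdaConvex lam φ) ∨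
      (EVIFlow.IsCoercive φ ∧
        ∃ (K : ℝ) (Γ : Set (ℝ → X)), EVIFlow.IsAdmissibleFamily lam K φ Γ))
    (x₀ : X) (hx₀ : x₀ ∈ EVIFlow.domain φ) :
    EVIFlow.IsGradientCurve φ x₀ (fun t => EVIFlow.gradientFlow φ t x₀) ∧
    (∀ t : ℝ, 0 ≤ t → EVIFlow.gradientFlow φ t x₀ ∈ EVIFlow.domain φ) ∧
    (∀ y ∈ EVIFlow.domain φ, ∀ t : ℝ, 0 < t →
      Filter.limsup (fun ε : ℝ =>
          (((dist (EVIFlow.gradientFlow φ (t + ε) x₀) y ^ 2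
              - dist (EVIFlow.gradientFlow φ t x₀) y ^ 2) / (2 * ε) : ℝ) : EReal))
          (nhdsWithin 0 (Set.Ioi 0))
        + ((lam / 2 * dist (EVIFlow.gradientFlow φ t x₀) y ^ 2 : ℝ) : EReal)
        + φ (EVIFlow.gradientFlow φ t x₀) ≤ φ y) ∧
    (∀ y ∈ EVIFlow.domain φ,
      ∀ᵐ t ∂(MeasureTheory.volume.restrict (Set.Ioi (0 : ℝ))),
        ∃ v : ℝ, HasDerivAt (fun s : ℝ => dist (EVIFlow.gradientFlow φ s x₀) y ^ 2) v t ∧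
          ((1 / 2 * v : ℝ) : EReal)
            + ((lam / 2 * dist (EVIFlow.gradientFlow φ t x₀) y ^ 2 : ℝ) : EReal)
            + φ (EVIFlow.gradientFlow φ t x₀) ≤ φ y) := by
  obtain ⟨C, hφ⟩ : ∃ C, EVIFlow.IsEVIPotential lam C φ x₀ := by
    rcases hcase with ⟨hX, hdiam, hconv⟩ | ⟨hcoercive, K, Γ, hΓ⟩
    · exact hX.exists_isEVIPotential hdiam hφ_bot hφ_lsc hconv hx₀
    · exact ⟨_, hΓ.isEVIPotential hcoercive hφ_bot hφ_lsc hx₀⟩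
  have hξ := hφ.isGradientCurve_gradientFlow
  exact ⟨hξ, fun t ht => hφ.mem_domain_of_isGradientCurve hξ ht,
    fun y hy t ht => hφ.limsup_evi hξ hy ht.le, fun y hy => hφ.ae_evi hξ hy⟩
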